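/- Let $k=\mathbb{F}_q$ be a finite field with $q$ elements, let $r\ge 1$, let $K=\mathbb{F}_{q^r}$ be an extension of $k$ of degree $r$, and let $\sigma\colon K\to K$, $\sigma(x)=x^q$. Let $K[X,\sigma]$ be the ring of skew polynomials $\sum_i a_iX^i$ with coefficients in $K$, with the usual addition and with the multiplication determined by $X\cdot a=\sigma(a)X$ for $a\in K$. For a monic $P=X^d-\sum_{i=0}^{d-1}a_iX^i\in K[X,\sigma]$ let $D_P=\bigoplus_{i=0}^{d-1}Ke_i$, and let $\varphi\colon D_P\to D_P$ be the $\sigma$-semilinear map with $\varphi(e_i)=e_{i+1}$ for $0\le i\le d-2$ and $\varphi(e_{d-1})=\sum_{i=0}^{d-1}a_ie_i$. Then $\varphi^r$ is $K$-linear and its characteristic polynomial $\Psi(P)=\det(Y\,\mathrm{id}-\varphi^r)$ has coefficients in $\mathbb{F}_q$. (1) Let $Q\in\mathbb{F}_q[Y]$ be a monic irreducible polynomial of degree $d$, and assume that $Q\ne Y$ or $r=1$. Then the number of monic $P\in\mathbb{F}_{q^r}[X,\sigma]$ such that $\Psi(P)=Q$ is $$\frac{q^{dr}-1}{q^d-1}.$$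 (2) Let $d\ge 1$ be an integer, and assume that $d\ge 2$ or $r=1$. Then the number of monic irreducible polynomials of degree $d$ in $\mathbb{F}_{q^r}[X,\sigma]$ is $$\frac{q^{dr}-1}{d\,(q^d-1)}\sum_{i\mid d}\mu\!\left(\frac{d}{i}\right)q^i,$$ where $\mu$ is the Möbius function. -/

import Mathlib

open Polynomial

noncomputable section

/-! ### The skew polynomial ring `K[X, σ]` -/

/-- The action of `ℕ` on `K` in which `n` acts as `σ ^ n`. -/
@[reducible] def skewAction {K : Type*} [Field K] (σ : K →+* K) :
    MulSemiringAction (Multiplicative ℕ) K :=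
  MulSemiringAction.compHom K (powersHom (K →+* K) σ)

/-- The ring `K[X, σ]` of skew polynomials `∑ aᵢ X ^ i` with `X * a = σ a * X`. -/
def SkewPoly {K : Type*} [Field K] (_σ : K →+* K) : Type _ := SkewPolynomial K

namespace SkewPoly

section Basic

variable {K : Type*} [Field K] {σ : K →+* K}

instance : Ring (SkewPoly σ) :=
  letI := skewAction σ
  inferInstanceAs (Ring (SkewPolynomial K))

/-- The monomial `a X ^ n`. -/
def monomial (σ : K →+* K) (n : ℕ) (a : K) : SkewPoly σ := SkewPolynomial.monomial n a

/-- The coefficient of `X ^ n`. -/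
def coeff (P : SkewPoly σ) (n : ℕ) : K := SkewPolynomial.coeff P n

/-- The degree, with value `0` at the zero polynomial. -/
def natDegree (P : SkewPoly σ) : ℕ := (SkewPolynomial.support P).sup id

/-- The leading coefficient is `1`. -/
def Monic (P : SkewPoly σ) : Prop := P.coeff P.natDegree = 1

theorem skewAction_smul (σ : K →+* K) (n : ℕ) (a : K) :
    (skewAction σ).smul (Multiplicative.ofAdd n) a = (σ ^ n) a := rfl

/-- The multiplication rule of `K[X, σ]`. -/
theorem monomial_mul_monomial (m n : ℕ) (a b : K) :
    monomial σ m a * monomial σ n b = monomial σ (m + n) (a * (σ ^ m) b) := by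
  let := skewAction σ
  refine (SkewPolynomial.monomial_mul_monomial m n a b).trans ?_
  rw [SkewPolynomial.φ_iterate_apply]
  rfl

/-! ### The `φ`-module `D_P` -/

/-- The images `φ(e_i)`: they are `e_{i+1}` for `i < d - 1`, and `∑ aⱼ eⱼ` for `i = d - 1`,
where `P = X ^ d - ∑ aⱼ X ^ j`. -/
def phiBasis (P : SkewPoly σ) (i : Fin P.natDegree) : Fin P.natDegree → K :=
  if h : (i : ℕ) + 1 < P.natDegree then Pi.single ⟨i + 1, h⟩ 1 else fun j => -P.coeff j

/-- The `σ`-semilinear map `φ` of the `φ`-module `D_P = K ^ d`, where `d` is the degree of `P`. -/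
def phi (P : SkewPoly σ) : (Fin P.natDegree → K) →ₛₗ[σ] (Fin P.natDegree → K) where
  toFun v := ∑ i, σ (v i) • P.phiBasis i
  map_add' v w := by simp [add_smul, Finset.sum_add_distrib]
  map_smul' c v := by simp [Finset.smul_sum, mul_smul]

theorem phi_iterate_smul (P : SkewPoly σ) (n : ℕ) (c : K) (v : Fin P.natDegree → K) :
    P.phi^[n] (c • v) = (σ^[n] c) • P.phi^[n] v := by
  induction n with
  | zero => rfl
  | succ n ih => simp only [Function.iterate_succ_apply', ih, map_smulₛₗ]

theorem phi_iterate_add (P : SkewPoly σ) (n : ℕ) (v w : Fin P.natDegree → K) :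
    P.phi^[n] (v + w) = P.phi^[n] v + P.phi^[n] w := by
  induction n with
  | zero => rfl
  | succ n ih => simp only [Function.iterate_succ_apply', ih, map_add]

/-- If `σ ^ r = id`, then `φ ^ r` is a `K`-linear endomorphism of `D_P`. -/
def phiPow (P : SkewPoly σ) (r : ℕ) (hr : ∀ c, σ^[r] c = c) :
    (Fin P.natDegree → K) →ₗ[K] (Fin P.natDegree → K) where
  toFun := P.phi^[r]
  map_add' := P.phi_iterate_add r
  map_smul' c v := by rw [phi_iterate_smul, hr, RingHom.id_apply]

/-- The matrix `Γ` of `φ`. -/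
def phiMatrix (P : SkewPoly σ) : Matrix (Fin P.natDegree) (Fin P.natDegree) K :=
  Matrix.of fun i j => P.phiBasis j i

theorem phi_apply (P : SkewPoly σ) (v : Fin P.natDegree → K) :
    P.phi v = P.phiMatrix.mulVec (σ ∘ v) := by
  ext i
  simp [phi, phiMatrix, Matrix.mulVec, dotProduct, mul_comm]

/-- The matrix `Γ σ(Γ) ⋯ σⁿ⁻¹(Γ)` of `φ ^ n`. -/
def phiMatrixIter (P : SkewPoly σ) : ℕ → Matrix (Fin P.natDegree) (Fin P.natDegree) K
  | 0 => 1
  | n + 1 => P.phiMatrix * (P.phiMatrixIter n).map σ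

theorem phi_iterate_apply (P : SkewPoly σ) (n : ℕ) (v : Fin P.natDegree → K) :
    P.phi^[n] v = (P.phiMatrixIter n).mulVec (σ^[n] ∘ v) := by
  induction n with
  | zero => simp [phiMatrixIter]
  | succ n ih =>
    rw [Function.iterate_succ_apply', ih, phi_apply, phiMatrixIter, ← Matrix.mulVec_mulVec]
    congr 1
    ext i
    have hc : ∀ x, σ (σ^[n] x) = σ^[n] (σ x) := fun x =>
      (Function.iterate_succ_apply' σ n x).symm
    simp [Matrix.mulVec, dotProduct, hc]

theorem phiMatrixIter_succ' (P : SkewPoly σ) (n : ℕ) :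
    P.phiMatrixIter (n + 1) = P.phiMatrixIter n * P.phiMatrix.map σ^[n] := by
  induction n with
  | zero => simp [phiMatrixIter]
  | succ n ih =>
    rw [phiMatrixIter, ih, Matrix.map_mul, ← mul_assoc, ← phiMatrixIter]
    congr 1
    ext i j
    exact (Function.iterate_succ_apply' σ n _).symm

theorem charpoly_phiPow_map (P : SkewPoly σ) (r : ℕ) (hr : ∀ c, σ^[r] c = c) :
    (P.phiPow r hr).charpoly.map σ = (P.phiPow r hr).charpoly := by
  have hM : P.phiPow r hr = Matrix.toLin' (P.phiMatrixIter r) := by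
    ext1 i
    ext1
    have : σ^[r] = id := funext hr
    simp only [LinearMap.comp_apply, Matrix.toLin'_apply]
    exact (P.phi_iterate_apply r _).trans (by rw [this, Function.id_comp])
  rw [hM, Matrix.charpoly_toLin', ← Matrix.charpoly_map]
  cases r with
  | zero => simp [phiMatrixIter]
  | succ n =>
    have h1 : (P.phiMatrixIter (n + 1)).map σ = (P.phiMatrixIter n).map σ * P.phiMatrix := by
      rw [phiMatrixIter_succ', Matrix.map_mul]
      congr 1
      ext i j
      have := hr (P.phiMatrix i j)
      rw [Function.iterate_succ_apply'] at this
      simpa using this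
    rw [h1, Matrix.charpoly_mul_comm, phiMatrixIter]

end Basic

/-! ### The map `Ψ` over finite fields -/

section Finite

variable (k K : Type*) [Field k] [Fintype k] [Field K] [Algebra k K]

/-- The endomorphism `x ↦ x ^ q` of `K`, where `q` is the cardinality of `k`. -/
abbrev frob : K →+* K := (FiniteField.frobeniusAlgHom k K : K →+* K)

theorem frob_iterate_finrank [Finite K] (c : K) : (frob k K)^[Module.finrank k K] c = c := by
  have := congr($(pow_orderOf_eq_one (FiniteField.frobeniusAlgHom k K)) c)
  rw [FiniteField.orderOf_frobeniusAlgHom, AlgHom.coe_pow] at this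
  exact this

theorem mem_range_of_frob_eq {c : K} (h : frob k K c = c) : c ∈ Set.range (algebraMap k K) := by
  have hc : c ^ Fintype.card k = c := h
  have hq : 1 < Fintype.card k := Fintype.one_lt_card
  have hs : (X ^ Fintype.card k - X : k[X]).Splits := by
    rw [splits_iff_card_roots, FiniteField.roots_X_pow_card_sub_X,
      FiniteField.X_pow_card_sub_X_natDegree_eq k hq]
    rfl
  have hroot : c ∈ (map (algebraMap k K) (X ^ Fintype.card k - X)).roots := by
    rw [mem_roots (map_ne_zero (FiniteField.X_pow_card_sub_X_ne_zero k hq))]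
    simp [hc]
  rw [hs.roots_map, Multiset.mem_map] at hroot
  obtain ⟨a, -, ha⟩ := hroot
  exact ⟨a, ha⟩

variable {k K} [Finite K]

/-- The characteristic polynomial of `φ ^ r` on `D_P`, where `r = [K : k]`. -/
def charpolyPhiPow (P : SkewPoly (frob k K)) : K[X] :=
  (P.phiPow (Module.finrank k K) (frob_iterate_finrank k K)).charpoly

theorem charpolyPhiPow_mem_lifts (P : SkewPoly (frob k K)) :
    ∃ Q : k[X], Q.map (algebraMap k K) = P.charpolyPhiPow := by
  rw [← mem_lifts, lifts_iff_coeff_lifts]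
  intro n
  apply mem_range_of_frob_eq
  rw [← coeff_map]
  exact congr(($(P.charpoly_phiPow_map _ (frob_iterate_finrank k K))).coeff n)

/-- `Ψ(P) ∈ k[Y]` is the characteristic polynomial of `φ ^ r` on `D_P`; see `map_Psi`. -/
def Psi (P : SkewPoly (frob k K)) : k[X] := P.charpolyPhiPow_mem_lifts.choose

theorem map_Psi (P : SkewPoly (frob k K)) :
    P.Psi.map (algebraMap k K) = P.charpolyPhiPow :=
  P.charpolyPhiPow_mem_lifts.choose_spec

end Finite

end SkewPoly

end

/-! ### Finite simple rings -/

/-! Write `A = K[X, σ]`. Division on the right by monic polynomials makes every nonzero left ideal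
of `A` equal to `AP` for a unique monic `P`, and `F ↦ F e₀` identifies `A/AP` with `D_P`. Since `σ`
has order `r`, each `f(X ^ r)` with `f ∈ k[Y]` is central, and it acts on `D_P` as `f(φ ^ r)`. So
`f(X ^ r) ∈ AP` if and only if `f(φ ^ r) = 0`, and Cayley–Hamilton puts `Ψ(P)(X ^ r)` in `AP`
(`Monic.centralHom_Psi_mem_span`).

Let `Q` be monic irreducible of degree `d`, with `Q ≠ Y` or `r = 1`. Then `R = A/AQ(X ^ r)` is
simple (`isSimpleRing_quotient`), with centre `k[Y]/(Q)` of order `q ^ d`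
(`natCard_center_quotient`). As `R` has order `q ^ (d r ^ 2)`, Wedderburn's theorems make it the
ring of `r × r` matrices over the field with `q ^ d` elements. Its simple module `V` has order `q ^
(d r)`, which forces the monic generators of the maximal left ideals over `Q(X ^ r)` to have degree
`d`. These ideals are the annihilators of the nonzero vectors of `V`, each arising from `q ^ d - 1`
vectors, so their number is the quotient in (1). By the equality of degrees, `Ψ(P) = Q` exactly when
`AP` is one of them (`Monic.Psi_eq_iff`).

For (2), a maximal `AP` meets the centre in a nonzero prime, so it lies over some irreducible `Q`;
`Q = Y` is possible for `r > 1` only if `P = X`. Hence `P` is irreducible if and only if `Ψ(P)` is,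
and (1) is multiplied by the number of monic irreducible `Q` of degree `d`, found by Möbius
inversion. -/

theorem natCard_quotient_eq {A B : Type*} [Ring A] [AddCommGroup B] {M : Ideal A} (f : A →+ B)
    (hf : Function.Surjective f) (hM : ∀ x, f x = 0 ↔ x ∈ M) : Nat.card (A ⧸ M) = Nat.card B := by
  have h : M.toAddSubgroup = f.ker := by
    ext x
    exact (hM x).symm
  change Nat.card (A ⧸ M.toAddSubgroup) = Nat.card B
  rw [h]
  exact Nat.card_congr (QuotientAddGroup.quotientKerEquivOfSurjective f hf).toEquiv

namespace IsSimpleRing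

variable (R : Type*) [Ring R]

/-- Wedderburn's little theorem makes `D` commutative, so every scalar matrix is central. -/
theorem card_center_matrix (D : Type*) [DivisionRing D] [Finite D] (n : ℕ) [NeZero n] :
    Nat.card (Subring.center (Matrix (Fin n) (Fin n) D)) = Nat.card D := by
  have hcomm : ∀ a b : D, a * b = b * a := (littleWedderburn D).mul_comm
  have hmem : ∀ M : Matrix (Fin n) (Fin n) D,
      M ∈ Subring.center (Matrix (Fin n) (Fin n) D) ↔ M ∈ Set.range (Matrix.scalar (Fin n)) := by
    intro M
    constructor
    · intro h
      rw [Matrix.mem_range_scalar_iff_commute_single']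
      exact fun i j => Subring.mem_center_iff.mp h _
    · rintro ⟨a, rfl⟩
      rw [Subring.mem_center_iff]
      exact fun N => ((Matrix.scalar_commute a (fun b => hcomm a b) N).eq).symm
  have hset : (Subring.center (Matrix (Fin n) (Fin n) D) : Set (Matrix (Fin n) (Fin n) D)) =
      Set.range (Matrix.scalar (Fin n)) := Set.ext hmem
  have := Nat.card_range_of_injective (f := (Matrix.scalar (Fin n) : D →+* _))
    (RingHom.injective _)
  rw [← this, ← hset]
  rfl

/-- Wedderburn–Artin: `R ≅ V ^ n` as a left module, so `R` is a matrix ring over `D = (End V)ᵐᵒᵖ`.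
Then `|V| ^ n = |R| = |D| ^ (n * n)`, and taking `n`-th roots gives `|V|`. -/
theorem exists_card_eq_pow [IsSimpleRing R] [Finite R] (V : Type*) [AddCommGroup V] [Module R V]
    [Finite V] [IsSimpleModule R V] :
    Nat.card (Module.End R V) = Nat.card (Subring.center R) ∧
      ∃ n, Nat.card V = Nat.card (Subring.center R) ^ n ∧
        Nat.card R = Nat.card (Subring.center R) ^ (n * n) := by
  classical
  obtain ⟨n, hn, S, hS, ⟨e⟩⟩ := (isIsotypic R R).linearEquiv_fun
  obtain ⟨I, ⟨eI⟩⟩ := IsSemisimpleRing.exists_linearEquiv_ideal_of_isSimpleModule R V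
  have hI : IsSimpleModule R I := IsSimpleModule.congr eI.symm
  obtain ⟨eS⟩ := isIsotypic R R S I
  let e' : R ≃ₗ[R] (Fin n → V) := e.trans (LinearEquiv.piCongrRight fun _ => (eI.trans eS).symm)
  -- `Rᵐᵒᵖ` is the endomorphism ring of the left module `R`; the second opposite is moved into the
  -- matrix entries.
  let ρ : R ≃+* Matrix (Fin n) (Fin n) (Module.End R V)ᵐᵒᵖ :=
    .trans (.opOp R) <| .trans (.op <| .trans (.moduleEndSelf R) <|
      .trans e'.conjRingEquiv (endVecRingEquivMatrixEnd ..)) (.symm .mopMatrix)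
  have hfin : Finite (Module.End R V) := Finite.of_injective _ DFunLike.coe_injective
  have hfop : Finite (Module.End R V)ᵐᵒᵖ := Finite.of_equiv _ MulOpposite.opEquiv
  have hop : Nat.card (Module.End R V)ᵐᵒᵖ = Nat.card (Module.End R V) :=
    Nat.card_congr MulOpposite.opEquiv.symm
  have hc : Nat.card (Subring.center R) = Nat.card (Module.End R V) := by
    rw [Nat.card_congr (Subring.centerCongr ρ).toEquiv, card_center_matrix, hop]
  have hR : Nat.card R = Nat.card (Module.End R V) ^ (n * n) := by
    rw [Nat.card_congr ρ.toEquiv, Matrix, Nat.card_fun, Nat.card_fun, hop, Nat.card_fin, pow_mul]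
  have hRV : Nat.card R = Nat.card V ^ n := by
    rw [Nat.card_congr e'.toEquiv, Nat.card_fun, Nat.card_fin]
  refine ⟨hc.symm, n, ?_, hc ▸ hR⟩
  rw [hc]
  exact Nat.pow_left_injective hn.ne (by
    simp only
    rw [← hRV, hR, pow_mul])

theorem nonempty_linearEquiv [IsSimpleRing R] [IsArtinianRing R] (V W : Type*) [AddCommGroup V]
    [Module R V] [IsSimpleModule R V] [AddCommGroup W] [Module R W] [IsSimpleModule R W] :
    Nonempty (V ≃ₗ[R] W) := by
  obtain ⟨I, ⟨eI⟩⟩ := IsSemisimpleRing.exists_linearEquiv_ideal_of_isSimpleModule R V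
  obtain ⟨J, ⟨eJ⟩⟩ := IsSemisimpleRing.exists_linearEquiv_ideal_of_isSimpleModule R W
  have hI : IsSimpleModule R I := IsSimpleModule.congr eI.symm
  have hJ : IsSimpleModule R J := IsSimpleModule.congr eJ.symm
  obtain ⟨e⟩ := isIsotypic R R J I
  exact ⟨(eI.trans e).trans eJ.symm⟩

theorem isSimpleModule_quotient (M : Ideal R) [hM : M.IsMaximal] : IsSimpleModule R (R ⧸ M) :=
  isSimpleModule_iff_quot_maximal.mpr ⟨M, hM, ⟨LinearEquiv.refl R _⟩⟩

/-- Nonzero elements of a simple module correspond to pairs of a maximal left ideal `M` and a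
nonzero map from `R ⧸ M`. -/
theorem card_sigma_hom (V : Type*) [AddCommGroup V] [Module R V] [IsSimpleModule R V] :
    Nat.card (Σ M : {M : Ideal R // M.IsMaximal}, {f : (R ⧸ M.1) →ₗ[R] V // f ≠ 0}) =
      Nat.card {v : V // v ≠ 0} := by
  -- The pair `(M, f)` is recovered from the vector `v = f(1)`: `M` is the annihilator of `v`, and
  -- `f` is determined by its value at `1`.
  have hker : ∀ (M : Ideal R) (_ : M.IsMaximal) (f : (R ⧸ M) →ₗ[R] V), f ≠ 0 →
      ∀ x : R, x ∈ M ↔ x • f (M.mkQ 1) = 0 := by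
    intro M hM f hf x
    have := isSimpleModule_quotient R M
    have hinj := f.injective_or_eq_zero.resolve_right hf
    rw [← map_smul, ← map_smul, map_eq_zero_iff f hinj, smul_eq_mul, mul_one,
      Submodule.mkQ_apply, Submodule.Quotient.mk_eq_zero]
  refine Nat.card_congr (Equiv.ofBijective
    (fun p => ⟨p.2.1 (p.1.1.mkQ 1), fun h => ?_⟩) ⟨?_, ?_⟩)
  · refine p.1.2.ne_top ?_
    rw [Ideal.eq_top_iff_one, hker _ p.1.2 p.2.1 p.2.2, h, smul_zero]
  · rintro ⟨⟨M, hM⟩, f, hf⟩ ⟨⟨N, hN⟩, g, hg⟩ h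
    have h1 : f (M.mkQ 1) = g (N.mkQ 1) := congrArg Subtype.val h
    obtain rfl : M = N := by
      ext x
      rw [hker M hM f hf, hker N hN g hg, h1]
    have : f = g := by
      refine Submodule.linearMap_qext _ (LinearMap.ext_ring ?_)
      exact h1
    subst this
    rfl
  · rintro ⟨v, hv⟩
    let t := LinearMap.toSpanSingleton R V v
    have ht : Function.Surjective t := IsSimpleModule.toSpanSingleton_surjective R hv
    have hM : Ideal.IsMaximal (LinearMap.ker t) := by
      have : IsSimpleModule R (R ⧸ LinearMap.ker t) :=
        IsSimpleModule.congr (t.quotKerEquivOfSurjective ht)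
      exact ⟨isSimpleModule_iff_isCoatom.mp this⟩
    have h1 : (LinearMap.ker t).liftQ t le_rfl ((LinearMap.ker t).mkQ 1) = v := by
      simp [t]
    refine ⟨⟨⟨_, hM⟩, (LinearMap.ker t).liftQ t le_rfl, fun h => hv ?_⟩, Subtype.ext h1⟩
    rw [← h1, h, LinearMap.zero_apply]

theorem card_ne_zero_add_one (V : Type*) [Zero V] [Finite V] :
    Nat.card {v : V // v ≠ 0} + 1 = Nat.card V := by
  classical
  have := Fintype.ofFinite V
  rw [Nat.card_eq_fintype_card, Nat.card_eq_fintype_card, Fintype.card_subtype_compl,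
    Fintype.card_subtype_eq]
  have : 0 < Fintype.card V := Fintype.card_pos_iff.mpr ⟨0⟩
  omega

/-- The orders of a finite simple ring and of its simple modules, and the number of its maximal
left ideals, in terms of the order of the centre. -/
theorem exists_card_maximal [IsSimpleRing R] [Finite R] :
    ∃ n, Nat.card R = Nat.card (Subring.center R) ^ (n * n) ∧
      (∀ M : Ideal R, M.IsMaximal → Nat.card (R ⧸ M) = Nat.card (Subring.center R) ^ n) ∧
      Nat.card {M : Ideal R // M.IsMaximal} * (Nat.card (Subring.center R) - 1) =
        Nat.card (Subring.center R) ^ n - 1 := by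
  classical
  obtain ⟨M, hM⟩ := Ideal.exists_maximal R
  have := isSimpleModule_quotient R M
  have hfq : ∀ N : Ideal R, Finite (R ⧸ N) := fun N =>
    Finite.of_surjective N.mkQ N.mkQ_surjective
  obtain ⟨hD, n, hV, hR⟩ := exists_card_eq_pow R (R ⧸ M)
  refine ⟨n, hR, fun N hN => ?_, ?_⟩
  · have := isSimpleModule_quotient R N
    obtain ⟨e⟩ := nonempty_linearEquiv R (R ⧸ N) (R ⧸ M)
    rw [Nat.card_congr e.toEquiv, hV]
  · have hfI : Finite (Ideal R) := Finite.of_injective _ SetLike.coe_injective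
    have hfE : Finite (Module.End R (R ⧸ M)) := Finite.of_injective _ DFunLike.coe_injective
    have hft : Fintype {M : Ideal R // M.IsMaximal} := Fintype.ofFinite _
    -- All simple modules are isomorphic, so each fibre of `card_sigma_hom` is a copy of the nonzero
    -- elements of `End (R ⧸ M)`, which has the order of the centre.
    have h1 : ∀ N : {N : Ideal R // N.IsMaximal},
        Nat.card {f : (R ⧸ N.1) →ₗ[R] (R ⧸ M) // f ≠ 0} = Nat.card (Subring.center R) - 1 := by
      rintro ⟨N, hN⟩
      have := isSimpleModule_quotient R N
      obtain ⟨e⟩ := nonempty_linearEquiv R (R ⧸ N) (R ⧸ M)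
      have h2 := card_ne_zero_add_one (Module.End R (R ⧸ M))
      rw [← hD, ← h2, Nat.add_sub_cancel]
      refine Nat.card_congr ((e.arrowCongrAddEquiv (LinearEquiv.refl R _)).toEquiv.subtypeEquiv ?_)
      exact fun f => (EmbeddingLike.map_ne_zero_iff (f := e.arrowCongrAddEquiv _)).symm
    have hfin : ∀ N : {N : Ideal R // N.IsMaximal},
        Finite {f : (R ⧸ N.1) →ₗ[R] (R ⧸ M) // f ≠ 0} := fun N =>
      have : Finite ((R ⧸ N.1) →ₗ[R] (R ⧸ M)) := Finite.of_injective _ DFunLike.coe_injective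
      inferInstance
    have h3 := card_sigma_hom R (R ⧸ M)
    rw [Nat.card_sigma, Finset.sum_congr rfl (fun N _ => h1 N), Finset.sum_const, smul_eq_mul,
      Finset.card_univ, ← Nat.card_eq_fintype_card] at h3
    rw [h3, ← hV, ← card_ne_zero_add_one (R ⧸ M), Nat.add_sub_cancel]

/-- The same, for the maximal left ideals containing the kernel of a surjection onto a finite
simple ring. -/
theorem exists_card_maximal_of_surjective {A : Type*} [Ring A] [IsSimpleRing R] [Finite R]
    (π : A →+* R) (hπ : Function.Surjective π) :
    ∃ n, Nat.card R = Nat.card (Subring.center R) ^ (n * n) ∧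
      (∀ M : Ideal A, M.IsMaximal → RingHom.ker π ≤ M →
        Nat.card (A ⧸ M) = Nat.card (Subring.center R) ^ n) ∧
      {M : Ideal A | M.IsMaximal ∧ RingHom.ker π ≤ M}.ncard * (Nat.card (Subring.center R) - 1) =
        Nat.card (Subring.center R) ^ n - 1 := by
  obtain ⟨n, h1, h2, h3⟩ := exists_card_maximal R
  have hmap : ∀ M : Ideal A, M.IsMaximal → RingHom.ker π ≤ M →
      (M.map π).IsMaximal ∧ (M.map π).comap π = M := by
    intro M hM hk
    have hc : (M.map π).comap π = M := by
      rw [Ideal.comap_map_of_surjective π hπ]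
      exact sup_eq_left.mpr hk
    refine ⟨(Ideal.map_eq_top_or_isMaximal_of_surjective π hπ hM).resolve_left fun h => ?_, hc⟩
    rw [h, Ideal.comap_top] at hc
    exact hM.ne_top hc.symm
  refine ⟨n, h1, fun M hM hk => ?_, ?_⟩
  · obtain ⟨hm, hc⟩ := hmap M hM hk
    rw [← h2 _ hm]
    refine natCard_quotient_eq (((M.map π).mkQ.toAddMonoidHom).comp π.toAddMonoidHom)
      ((M.map π).mkQ_surjective.comp hπ) fun x => ?_
    conv_rhs => rw [← hc]
    exact Submodule.Quotient.mk_eq_zero _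
  · rw [← h3]
    congr 1
    rw [← Nat.card_coe_set_eq]
    refine Nat.card_congr ⟨fun M => ⟨M.1.map π, (hmap M.1 M.2.1 M.2.2).1⟩,
      fun N => ⟨N.1.comap π, ?_, ?_⟩, fun M => ?_, fun N => ?_⟩
    · have := N.2
      exact Ideal.comap_isMaximal_of_surjective π hπ
    · exact Ideal.comap_mono bot_le
    · exact Subtype.ext (hmap M.1 M.2.1 M.2.2).2
    · exact Subtype.ext (Ideal.map_comap_of_surjective π hπ N.1)

end IsSimpleRing

noncomputable section

/-! ### Coefficients, degree and division in `K[X, σ]` -/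

namespace SkewPoly

section Coefficients

variable {K : Type*} [Field K] {σ : K →+* K}

@[ext] theorem ext {F G : SkewPoly σ} (h : ∀ n, F.coeff n = G.coeff n) : F = G :=
  SkewMonoidAlgebra.ext fun a => h a.toAdd

@[simp] theorem coeff_zero (n : ℕ) : (0 : SkewPoly σ).coeff n = 0 := rfl

@[simp] theorem coeff_add (F G : SkewPoly σ) (n : ℕ) :
    (F + G).coeff n = F.coeff n + G.coeff n :=
  congr($(SkewMonoidAlgebra.coeff_add (k := K) (G := Multiplicative ℕ) F G) (Multiplicative.ofAdd n))

/-- The coefficient of `X ^ n` as an additive map. -/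
def coeffHom (σ : K →+* K) (n : ℕ) : SkewPoly σ →+ K where
  toFun F := F.coeff n
  map_zero' := coeff_zero n
  map_add' F G := coeff_add F G n

@[simp] theorem coeff_neg (F : SkewPoly σ) (n : ℕ) : (-F).coeff n = -F.coeff n :=
  map_neg (coeffHom σ n) F

@[simp] theorem coeff_sub (F G : SkewPoly σ) (n : ℕ) :
    (F - G).coeff n = F.coeff n - G.coeff n :=
  map_sub (coeffHom σ n) F G

theorem coeff_sum {ι : Type*} (s : Finset ι) (f : ι → SkewPoly σ) (n : ℕ) :
    (∑ i ∈ s, f i).coeff n = ∑ i ∈ s, (f i).coeff n :=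
  map_sum (coeffHom σ n) f s

theorem coeff_monomial (m n : ℕ) (a : K) :
    (monomial σ m a).coeff n = if m = n then a else 0 :=
  SkewPolynomial.coeff_monomial

theorem monomial_zero_one : monomial σ 0 1 = 1 := rfl

theorem coeff_one (n : ℕ) : (1 : SkewPoly σ).coeff n = if 0 = n then 1 else 0 := by
  rw [← monomial_zero_one, coeff_monomial]

theorem monomial_add (n : ℕ) (a b : K) :
    monomial σ n (a + b) = monomial σ n a + monomial σ n b :=
  SkewPolynomial.monomial_add n a b

@[simp] theorem monomial_zero (n : ℕ) : monomial σ n 0 = 0 :=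
  SkewPolynomial.monomial_zero_right n

@[elab_as_elim]
theorem induction {motive : SkewPoly σ → Prop} (F : SkewPoly σ) (zero : motive 0)
    (add : ∀ F G, motive F → motive G → motive (F + G))
    (monomial : ∀ n a, motive (monomial σ n a)) : motive F :=
  SkewPolynomial.induction (motive := motive) F zero fun n a _ _ _ h => add _ _ (monomial n a) h

theorem coeff_mul_monomial (F : SkewPoly σ) (m n : ℕ) (b : K) :
    (F * monomial σ n b).coeff (m + n) = F.coeff m * (σ ^ m) b := by
  induction F using induction with
  | zero => simp
  | add F G hF hG => simp [add_mul, hF, hG]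
  | monomial i a =>
    rw [monomial_mul_monomial, coeff_monomial, coeff_monomial]
    by_cases h : i = m
    · simp [h]
    · simp [h]

theorem coeff_mul_monomial_of_lt (F : SkewPoly σ) {m n : ℕ} (h : m < n) (b : K) :
    (F * monomial σ n b).coeff m = 0 := by
  induction F using induction with
  | zero => simp
  | add F G hF hG => simp [add_mul, hF, hG]
  | monomial i a =>
    rw [monomial_mul_monomial, coeff_monomial, if_neg (by omega)]

theorem coeff_monomial_mul (F : SkewPoly σ) (m n : ℕ) (a : K) :
    (monomial σ n a * F).coeff (m + n) = a * (σ ^ n) (F.coeff m) := by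
  induction F using induction with
  | zero => simp
  | add F G hF hG => simp [mul_add, hF, hG]
  | monomial i b =>
    rw [monomial_mul_monomial, coeff_monomial, coeff_monomial]
    by_cases h : i = m
    · simp [h, add_comm]
    · rw [if_neg (by omega), if_neg h, map_zero, mul_zero]

theorem coeff_monomial_mul_of_lt (F : SkewPoly σ) {m n : ℕ} (h : m < n) (a : K) :
    (monomial σ n a * F).coeff m = 0 := by
  induction F using induction with
  | zero => simp
  | add F G hF hG => simp [mul_add, hF, hG]
  | monomial i b =>
    rw [monomial_mul_monomial, coeff_monomial, if_neg (by omega)]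

theorem monomial_zero_mul_coeff (F : SkewPoly σ) (m : ℕ) (a : K) :
    (monomial σ 0 a * F).coeff m = a * F.coeff m := by
  simpa using coeff_monomial_mul F m 0 a

/-- The skew polynomials of degree less than `n`. -/
def degreeLT (σ : K →+* K) (n : ℕ) : AddSubgroup (SkewPoly σ) where
  carrier := {F | ∀ i, n ≤ i → F.coeff i = 0}
  zero_mem' _ _ := rfl
  add_mem' hF hG i hi := by rw [coeff_add, hF i hi, hG i hi, add_zero]
  neg_mem' hF i hi := by rw [coeff_neg, hF i hi, neg_zero]

theorem mem_degreeLT {n : ℕ} {F : SkewPoly σ} :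
    F ∈ degreeLT σ n ↔ ∀ i, n ≤ i → F.coeff i = 0 := Iff.rfl

theorem monomial_mem_degreeLT {m n : ℕ} (h : m < n) (a : K) : monomial σ m a ∈ degreeLT σ n :=
  fun i hi => by rw [coeff_monomial, if_neg (by omega)]

theorem mem_degreeLT_natDegree_succ (F : SkewPoly σ) : F ∈ degreeLT σ (F.natDegree + 1) := by
  intro i hi
  by_contra h
  have : i ∈ SkewPolynomial.support F := SkewPolynomial.mem_support_iff.mpr h
  have := Finset.le_sup (f := id) this
  exact absurd hi (by simpa [natDegree] using Nat.lt_succ_of_le this)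

theorem natDegree_le_of_mem_degreeLT {n : ℕ} {F : SkewPoly σ} (h : F ∈ degreeLT σ (n + 1)) :
    F.natDegree ≤ n := by
  refine Finset.sup_le fun i hi => ?_
  by_contra hn
  exact SkewPolynomial.mem_support_iff.mp hi (h i (by simp at hn; omega))

theorem natDegree_eq_of_mem_degreeLT {n : ℕ} {F : SkewPoly σ} (h : F ∈ degreeLT σ (n + 1))
    (hn : F.coeff n ≠ 0) : F.natDegree = n := by
  refine le_antisymm (natDegree_le_of_mem_degreeLT h) ?_
  by_contra hlt
  exact hn (mem_degreeLT_natDegree_succ F n (by omega))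

theorem eq_sum_monomial {n : ℕ} {F : SkewPoly σ} (h : F ∈ degreeLT σ n) :
    F = ∑ i : Fin n, monomial σ i (F.coeff i) := by
  ext m
  rw [coeff_sum]
  simp only [coeff_monomial]
  by_cases hm : m < n
  · rw [Finset.sum_eq_single ⟨m, hm⟩]
    · simp
    · intro i _ hi
      rw [if_neg fun h => hi (Fin.ext h)]
    · simp
  · rw [h m (by omega), Finset.sum_eq_zero]
    intro i _
    rw [if_neg (by omega)]

theorem Monic.ne_zero {P : SkewPoly σ} (hP : P.Monic) : P ≠ 0 := by
  rintro rfl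
  exact zero_ne_one hP

/-- Division with remainder on the right by a monic skew polynomial. -/
theorem Monic.exists_eq_mul_add {P : SkewPoly σ} (hP : P.Monic) (F : SkewPoly σ) :
    ∃ G, ∃ R ∈ degreeLT σ P.natDegree, F = G * P + R := by
  suffices h : ∀ n, ∀ F ∈ degreeLT σ n, ∃ G, ∃ R ∈ degreeLT σ P.natDegree, F = G * P + R from
    h _ F (mem_degreeLT_natDegree_succ F)
  intro n
  induction n with
  | zero => exact fun F hF => ⟨0, F, fun i _ => hF i (Nat.zero_le i), by simp⟩
  | succ n ih =>
    intro F hF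
    by_cases hn : n < P.natDegree
    · exact ⟨0, F, fun i hi => hF i (by omega), by simp⟩
    obtain ⟨m, rfl⟩ := Nat.exists_eq_add_of_le (not_lt.mp hn)
    have hM : monomial σ m (F.coeff (P.natDegree + m)) * P ∈ degreeLT σ (P.natDegree + m + 1) := by
      intro i hi
      obtain ⟨j, rfl⟩ := Nat.exists_eq_add_of_le' (show m ≤ i by omega)
      rw [coeff_monomial_mul, mem_degreeLT_natDegree_succ P j (by omega), map_zero, mul_zero]
    obtain ⟨G, R, hR, h⟩ := ih (F - monomial σ m (F.coeff (P.natDegree + m)) * P) (by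
      intro i hi
      rcases eq_or_lt_of_le hi with rfl | hi
      · rw [coeff_sub, coeff_monomial_mul, hP, map_one, mul_one, sub_self]
      · exact sub_mem hF hM i hi)
    exact ⟨G + monomial σ m (F.coeff (P.natDegree + m)), R, hR, by
      rw [add_mul, add_right_comm, ← h, sub_add_cancel]⟩

theorem monomial_one_pow (m n : ℕ) :
    monomial σ m 1 ^ n = monomial σ (m * n) 1 := by
  induction n with
  | zero => rfl
  | succ n ih => rw [pow_succ, ih, monomial_mul_monomial, map_one, one_mul, mul_add_one]

/-! ### Commutators -/

/-- Vanishing of this commutator says that the coefficients are fixed by `σ`, one half of the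
description of central elements. -/
theorem coeff_commutator_X_succ (F : SkewPoly σ) (i : ℕ) :
    (monomial σ 1 1 * F - F * monomial σ 1 1).coeff (i + 1) = σ (F.coeff i) - F.coeff i := by
  simp [coeff_monomial_mul, coeff_mul_monomial]

theorem coeff_commutator_X_zero (F : SkewPoly σ) :
    (monomial σ 1 1 * F - F * monomial σ 1 1).coeff 0 = 0 := by
  simp [coeff_monomial_mul_of_lt, coeff_mul_monomial_of_lt]

/-- The two constants are independent so that `b = σ ^ m a` can cancel the term of degree `m`.
Vanishing restricts the exponents that occur. -/
theorem coeff_commutator_C (F : SkewPoly σ) (a b : K) (i : ℕ) :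
    (F * monomial σ 0 a - monomial σ 0 b * F).coeff i = F.coeff i * ((σ ^ i) a - b) := by
  rw [coeff_sub, monomial_zero_mul_coeff, show i = i + 0 from rfl, coeff_mul_monomial, mul_sub,
    mul_comm b]
  rfl

theorem coeff_mul_zero (F G : SkewPoly σ) :
    (F * G).coeff 0 = F.coeff 0 * G.coeff 0 := by
  induction F using induction with
  | zero => simp
  | add F H hF hH => simp [add_mul, hF, hH]
  | monomial n a =>
    rcases Nat.eq_zero_or_pos n with rfl | hn
    · rw [monomial_zero_mul_coeff, coeff_monomial, if_pos rfl]
    · rw [coeff_monomial_mul_of_lt _ hn, coeff_monomial, if_neg hn.ne', zero_mul]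

theorem mul_mem_degreeLT {F G : SkewPoly σ} {m n : ℕ} (hF : F ∈ degreeLT σ m)
    (hG : G ∈ degreeLT σ (n + 1)) : F * G ∈ degreeLT σ (m + n) := by
  rw [eq_sum_monomial hF, Finset.sum_mul]
  refine sum_mem fun i _ j hj => ?_
  have := i.2
  obtain ⟨l, rfl⟩ := Nat.exists_eq_add_of_le' (show (i : ℕ) ≤ j by omega)
  rw [coeff_monomial_mul, hG l (by omega), map_zero, mul_zero]

/-- Without its top term, `F` multiplies `G` into too low a degree to contribute. Since `σ` is
injective, there are no zero divisors. -/
theorem coeff_mul_natDegree_add_natDegree (F G : SkewPoly σ) :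
    (F * G).coeff (F.natDegree + G.natDegree) =
      F.coeff F.natDegree * (σ ^ F.natDegree) (G.coeff G.natDegree) := by
  set m := F.natDegree with hm
  have h1 : F - monomial σ m (F.coeff m) ∈ degreeLT σ m := by
    intro i hi
    rcases eq_or_lt_of_le hi with rfl | hi
    · rw [coeff_sub, coeff_monomial, if_pos rfl, sub_self]
    · rw [coeff_sub, coeff_monomial, if_neg hi.ne, mem_degreeLT_natDegree_succ F i hi, sub_zero]
  have h2 := mul_mem_degreeLT h1 (mem_degreeLT_natDegree_succ G) (m + G.natDegree) le_rfl
  rw [sub_mul, coeff_sub, sub_eq_zero] at h2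
  rw [h2, add_comm, coeff_monomial_mul]

end Coefficients

/-! ### The module `D_P` and the left ideals of `K[X, σ]` -/

section Action

variable {K : Type*} [Field K] {σ : K →+* K}

/-- The map `φ` as an additive endomorphism. -/
def phiEnd (P : SkewPoly σ) : AddMonoid.End (Fin P.natDegree → K) := P.phi.toAddMonoidHom

theorem phiEnd_pow_apply (P : SkewPoly σ) (n : ℕ) (v : Fin P.natDegree → K) :
    (P.phiEnd ^ n) v = P.phi^[n] v := by
  rw [AddMonoid.End.coe_pow]
  rfl

/-- The action of `K[X, σ]` on `D_P` in which `X` acts as `φ`. -/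
def act (P : SkewPoly σ) : SkewPoly σ →+* AddMonoid.End (Fin P.natDegree → K) :=
  letI := skewAction σ
  SkewMonoidAlgebra.liftNCRingHom (Module.toAddMonoidEnd K (Fin P.natDegree → K))
    (powersHom (AddMonoid.End (Fin P.natDegree → K)) P.phiEnd) (by
      intro x y
      refine AddMonoidHom.ext fun v => ?_
      change (σ ^ y.toAdd) x • (P.phiEnd ^ y.toAdd) v = (P.phiEnd ^ y.toAdd) (x • v)
      rw [phiEnd_pow_apply, phiEnd_pow_apply, phi_iterate_smul, RingHom.coe_pow])

theorem act_monomial (P : SkewPoly σ) (n : ℕ) (a : K) (v : Fin P.natDegree → K) :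
    P.act (monomial σ n a) v = a • P.phi^[n] v := by
  have h : P.act (monomial σ n a) = Module.toAddMonoidEnd K (Fin P.natDegree → K) a *
      (powersHom (AddMonoid.End (Fin P.natDegree → K)) P.phiEnd) (Multiplicative.ofAdd n) :=
    SkewMonoidAlgebra.liftNC_single _ _ _ _
  rw [h, ← phiEnd_pow_apply]
  rfl

/-- The first basis vector `e₀` of `D_P`. -/
def cyclicVector (P : SkewPoly σ) : Fin P.natDegree → K := fun i => if (i : ℕ) = 0 then 1 else 0

/-- The map `K[X, σ] → D_P` sending `F` to `F e₀`. -/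
def ev (P : SkewPoly σ) : SkewPoly σ →+ (Fin P.natDegree → K) where
  toFun F := P.act F P.cyclicVector
  map_zero' := by simp
  map_add' F G := by rw [map_add]; rfl

theorem ev_mul (P F G : SkewPoly σ) : P.ev (F * G) = P.act F (P.ev G) := by
  simp [ev]

theorem ev_monomial (P : SkewPoly σ) (n : ℕ) (a : K) :
    P.ev (monomial σ n a) = a • P.phi^[n] P.cyclicVector :=
  act_monomial P n a _

theorem phi_single (P : SkewPoly σ) (i : Fin P.natDegree) :
    P.phi (Pi.single i 1) = P.phiBasis i := by
  change ∑ j, σ ((Pi.single i 1 : Fin P.natDegree → K) j) • P.phiBasis j = _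
  rw [Finset.sum_eq_single i]
  · simp
  · intro j _ hj
    simp [Pi.single_eq_of_ne hj]
  · simp

theorem phi_iterate_cyclicVector (P : SkewPoly σ) (n : ℕ) (hn : n < P.natDegree) :
    P.phi^[n] P.cyclicVector = Pi.single ⟨n, hn⟩ 1 := by
  induction n with
  | zero =>
    ext i
    simp [cyclicVector, Pi.single_apply, Fin.ext_iff]
  | succ n ih =>
    rw [Function.iterate_succ_apply', ih (by omega), phi_single, phiBasis, dif_pos hn]

theorem ev_of_mem_degreeLT (P : SkewPoly σ) {F : SkewPoly σ} (hF : F ∈ degreeLT σ P.natDegree) :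
    P.ev F = fun i : Fin P.natDegree => F.coeff i := by
  conv_lhs => rw [eq_sum_monomial hF, map_sum]
  ext j
  simp [ev_monomial, phi_iterate_cyclicVector, Pi.single_apply, Finset.sum_apply]

/-- The last column of `φ` is made for this: `φ ^ d e₀ = φ e_{d-1}` cancels the lower terms of `P
e₀`. -/
theorem Monic.ev_self {P : SkewPoly σ} (hP : P.Monic) : P.ev P = 0 := by
  -- In degree `0` there is no `e_{d-1}`, but `D_P` is zero.
  rcases Nat.eq_zero_or_pos P.natDegree with h0 | h0
  · have : IsEmpty (Fin P.natDegree) := by rw [h0]; infer_instance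
    exact Subsingleton.elim _ _
  have hR : P - monomial σ P.natDegree 1 ∈ degreeLT σ P.natDegree := by
    intro i hi
    rcases eq_or_lt_of_le hi with rfl | hi
    · rw [coeff_sub, coeff_monomial, if_pos rfl, hP, sub_self]
    · rw [coeff_sub, coeff_monomial, if_neg hi.ne, mem_degreeLT_natDegree_succ P i hi, sub_zero]
  have h1 : P.ev (monomial σ P.natDegree 1) = fun i : Fin P.natDegree => -P.coeff i := by
    rw [ev_monomial, one_smul]
    obtain ⟨d, hd⟩ := Nat.exists_eq_add_of_lt h0
    have hd' : P.natDegree = d + 1 := by omega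
    have hit : P.phi^[P.natDegree] = P.phi^[d + 1] := congrArg (fun n => P.phi^[n]) hd'
    rw [hit, Function.iterate_succ_apply', phi_iterate_cyclicVector P d (by omega), phi_single,
      phiBasis, dif_neg (by simp only; omega)]
  have h2 : P.ev P = P.ev (P - monomial σ P.natDegree 1) + P.ev (monomial σ P.natDegree 1) := by
    rw [← map_add, sub_add_cancel]
  rw [h2, h1, ev_of_mem_degreeLT P hR]
  ext i
  simp [coeff_monomial, i.2.ne']

/-- Modulo `P` only the remainder matters, and its coefficients are the coordinates of its image in
`D_P`. -/
theorem Monic.ev_eq_zero_iff {P : SkewPoly σ} (hP : P.Monic) (F : SkewPoly σ) :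
    P.ev F = 0 ↔ F ∈ Ideal.span {P} := by
  rw [Ideal.mem_span_singleton']
  constructor
  · intro h
    obtain ⟨G, R, hR, rfl⟩ := hP.exists_eq_mul_add F
    rw [map_add, ev_mul, hP.ev_self, map_zero, zero_add, ev_of_mem_degreeLT P hR] at h
    refine ⟨G, ?_⟩
    have : R = 0 := by
      ext i
      by_cases hi : i < P.natDegree
      · exact congrFun h ⟨i, hi⟩
      · exact hR i (not_lt.mp hi)
    rw [this, add_zero]
  · rintro ⟨G, rfl⟩
    rw [ev_mul, hP.ev_self, map_zero]

theorem ev_surjective (P : SkewPoly σ) : Function.Surjective P.ev := by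
  intro v
  refine ⟨∑ i : Fin P.natDegree, monomial σ i (v i), ?_⟩
  rw [map_sum]
  ext j
  simp [ev_monomial, phi_iterate_cyclicVector, Pi.single_apply, Finset.sum_apply]

theorem Monic.natCard_quotient {P : SkewPoly σ} (hP : P.Monic) :
    Nat.card (SkewPoly σ ⧸ Ideal.span {P}) = Nat.card K ^ P.natDegree := by
  rw [natCard_quotient_eq P.ev P.ev_surjective hP.ev_eq_zero_iff, Nat.card_fun, Nat.card_fin]

theorem Monic.eq_zero_of_mem_span {P : SkewPoly σ} (hP : P.Monic) {F : SkewPoly σ}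
    (hF : F ∈ Ideal.span {P}) (hd : F ∈ degreeLT σ P.natDegree) : F = 0 := by
  rw [← hP.ev_eq_zero_iff, ev_of_mem_degreeLT P hd] at hF
  ext i
  by_cases hi : i < P.natDegree
  · exact congrFun hF ⟨i, hi⟩
  · exact hd i (not_lt.mp hi)

theorem Monic.natDegree_le_of_mem_span {P F : SkewPoly σ} (hP : P.Monic)
    (hF : F ∈ Ideal.span {P}) (h0 : F ≠ 0) : P.natDegree ≤ F.natDegree := by
  by_contra h
  exact h0 (hP.eq_zero_of_mem_span hF fun i hi => mem_degreeLT_natDegree_succ F i (by omega))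

theorem Monic.sub_mem_degreeLT {P F : SkewPoly σ} (hP : P.Monic) (hF : F.Monic)
    (hd : P.natDegree = F.natDegree) : P - F ∈ degreeLT σ P.natDegree := by
  intro i hi
  rcases eq_or_lt_of_le hi with rfl | hi
  · rw [coeff_sub, hP, hd, hF, sub_self]
  · rw [coeff_sub, mem_degreeLT_natDegree_succ P i hi, mem_degreeLT_natDegree_succ F i (by omega),
      sub_zero]

theorem Monic.eq_of_span_eq {P F : SkewPoly σ} (hP : P.Monic) (hF : F.Monic)
    (h : Ideal.span {P} = Ideal.span {F}) : P = F := by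
  have hFP : F ∈ Ideal.span {P} := h ▸ Ideal.mem_span_singleton_self F
  have hPF : P ∈ Ideal.span {F} := h ▸ Ideal.mem_span_singleton_self P
  have hd := le_antisymm (hP.natDegree_le_of_mem_span hFP hF.ne_zero)
    (hF.natDegree_le_of_mem_span hPF hP.ne_zero)
  exact sub_eq_zero.mp (hP.eq_zero_of_mem_span
    (sub_mem (Ideal.mem_span_singleton_self P) hFP) (hP.sub_mem_degreeLT hF hd))

theorem coeff_natDegree_ne_zero {F : SkewPoly σ} (hF : F ≠ 0) : F.coeff F.natDegree ≠ 0 := by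
  have hs : (SkewPolynomial.support F).Nonempty :=
    Finset.nonempty_iff_ne_empty.mpr fun h => hF (SkewPolynomial.support_eq_empty.mp h)
  obtain ⟨i, hi, h⟩ := Finset.exists_mem_eq_sup _ hs id
  rw [natDegree, h]
  exact SkewPolynomial.mem_support_iff.mp hi

/-- Every nonzero left ideal of `K[X, σ]` is generated by a monic skew polynomial. -/
theorem exists_monic_span_eq {I : Ideal (SkewPoly σ)} (hI : I ≠ ⊥) :
    ∃ P : SkewPoly σ, P.Monic ∧ I = Ideal.span {P} := by
  classical
  obtain ⟨F, hF, hF0⟩ := Submodule.exists_mem_ne_zero_of_ne_bot hI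
  have hex : ∃ n, ∃ F ∈ I, F ≠ 0 ∧ F.natDegree = n := ⟨_, F, hF, hF0, rfl⟩
  obtain ⟨G, hG, hG0, hGn⟩ := Nat.find_spec hex
  have hc := coeff_natDegree_ne_zero hG0
  set P := monomial σ 0 (G.coeff G.natDegree)⁻¹ * G with hPdef
  have hPI : P ∈ I := I.mul_mem_left _ hG
  have hlead : P.coeff G.natDegree = 1 := by
    rw [hPdef, monomial_zero_mul_coeff, inv_mul_cancel₀ hc]
  have hdeg : P.natDegree = G.natDegree := by
    refine natDegree_eq_of_mem_degreeLT (fun i hi => ?_) (by rw [hlead]; exact one_ne_zero)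
    rw [hPdef, monomial_zero_mul_coeff, mem_degreeLT_natDegree_succ G i hi, mul_zero]
  have hP : P.Monic := by rw [Monic, hdeg, hlead]
  refine ⟨P, hP, le_antisymm (fun H hH => ?_) ((Ideal.span_singleton_le_iff_mem _).mpr hPI)⟩
  obtain ⟨A, R, hR, rfl⟩ := hP.exists_eq_mul_add H
  have hRI : R ∈ I := (Ideal.add_mem_iff_right _ (I.mul_mem_left A hPI)).mp hH
  have hR0 : R = 0 := by
    by_contra hR0
    have h1 := Nat.find_min' hex ⟨R, hRI, hR0, rfl⟩
    rw [← hGn, ← hdeg] at h1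
    exact coeff_natDegree_ne_zero hR0 (hR _ h1)
  rw [hR0, add_zero]
  exact Ideal.mul_mem_left _ _ (Ideal.mem_span_singleton_self P)

instance : NoZeroDivisors (SkewPoly σ) where
  eq_zero_or_eq_zero_of_mul_eq_zero {F G} h := by
    by_contra! hne
    have h1 := coeff_mul_natDegree_add_natDegree F G
    rw [h, coeff_zero, eq_comm, mul_eq_zero, map_eq_zero] at h1
    exact h1.elim (coeff_natDegree_ne_zero hne.1) (coeff_natDegree_ne_zero hne.2)

instance : Nontrivial (SkewPoly σ) :=
  ⟨0, 1, fun h => by simpa [coeff_one] using congrArg (fun F => coeff F 0) h⟩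

/-- In a domain, `(GF - 1)G = G(FG) - G = 0` turns a one-sided inverse into a two-sided one. -/
theorem isUnit_of_left_mul_eq_one {F G : SkewPoly σ} (h : F * G = 1) : IsUnit F ∧ IsUnit G := by
  have h0 : G ≠ 0 := right_ne_zero_of_mul_eq_one h
  have h1 : G * F = 1 := by
    rw [← sub_eq_zero]
    refine (mul_eq_zero.mp ?_).resolve_right h0
    rw [sub_mul, mul_assoc, h, mul_one, one_mul, sub_self]
  exact ⟨⟨⟨F, G, h, h1⟩, rfl⟩, ⟨⟨G, F, h1, h⟩, rfl⟩⟩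

theorem span_eq_top_of_isUnit {F : SkewPoly σ} (h : IsUnit F) : Ideal.span {F} = ⊤ := by
  obtain ⟨u, rfl⟩ := h
  rw [Ideal.eq_top_iff_one, Ideal.mem_span_singleton']
  exact ⟨_, u.inv_mul⟩

/-- A left ideal containing `P` is some `AG` with `P = FG`. It equals `AP` when `F` is a unit and
`A` when `G` is a unit. -/
theorem Monic.irreducible_iff {P : SkewPoly σ} (hP : P.Monic) :
    Irreducible P ↔ (Ideal.span {P}).IsMaximal := by
  constructor
  · intro h
    refine ⟨fun htop => h.not_isUnit ?_, fun J hJ => ?_⟩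
    · rw [Ideal.eq_top_iff_one, Ideal.mem_span_singleton'] at htop
      obtain ⟨G, hG⟩ := htop
      exact (isUnit_of_left_mul_eq_one hG).2
    · obtain ⟨G, hG, rfl⟩ := exists_monic_span_eq (bot_le.trans_lt hJ).ne'
      obtain ⟨F, hF⟩ := Ideal.mem_span_singleton'.mp (hJ.le (Ideal.mem_span_singleton_self P))
      rcases h.isUnit_or_isUnit hF.symm with ⟨u, rfl⟩ | hu
      · refine absurd ((Ideal.span_singleton_le_iff_mem _).mpr ?_) (not_le_of_gt hJ)
        rw [Ideal.mem_span_singleton', ← hF]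
        exact ⟨_, u.inv_mul_cancel_left G⟩
      · exact span_eq_top_of_isUnit hu
  · intro h
    refine ⟨fun hu => h.ne_top (span_eq_top_of_isUnit hu), fun F G hFG => ?_⟩
    have hle : Ideal.span {P} ≤ Ideal.span {G} := by
      rw [Ideal.span_singleton_le_iff_mem, Ideal.mem_span_singleton']
      exact ⟨F, hFG.symm⟩
    by_cases htop : Ideal.span {G} = ⊤
    · rw [Ideal.eq_top_iff_one, Ideal.mem_span_singleton'] at htop
      obtain ⟨H, hH⟩ := htop
      exact Or.inr (isUnit_of_left_mul_eq_one hH).2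
    · have hG := Ideal.mem_span_singleton_self G
      rw [← h.eq_of_le htop hle, Ideal.mem_span_singleton'] at hG
      obtain ⟨H, hH⟩ := hG
      have hG0 : G ≠ 0 := by
        rintro rfl
        exact hP.ne_zero (by rw [hFG, mul_zero])
      refine Or.inl (isUnit_of_left_mul_eq_one (F := H) ?_).2
      rw [← sub_eq_zero]
      refine (mul_eq_zero.mp ?_).resolve_right hG0
      rw [sub_mul, mul_assoc, ← hFG, hH, one_mul, sub_self]

theorem exists_monomial_mul_eq (m : ℕ) (F : SkewPoly σ) :
    ∃ G, monomial σ m 1 * F = G * monomial σ m 1 := by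
  induction F using induction with
  | zero => exact ⟨0, by simp⟩
  | add F G hF hG =>
    obtain ⟨F', hF⟩ := hF
    obtain ⟨G', hG⟩ := hG
    exact ⟨F' + G', by rw [mul_add, add_mul, hF, hG]⟩
  | monomial n a =>
    exact ⟨monomial σ n ((σ ^ m) a), by
      rw [monomial_mul_monomial, monomial_mul_monomial, map_one, mul_one, one_mul, add_comm]⟩

theorem exists_add_mul_eq_one {M : Ideal (SkewPoly σ)} (hM : M.IsMaximal) {F : SkewPoly σ}
    (hF : F ∉ M) : ∃ G ∈ M, ∃ H, G + H * F = 1 := by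
  have h : M ⊔ Ideal.span {F} = ⊤ := by
    refine hM.1.2 _ (lt_of_le_of_ne le_sup_left fun h => hF ?_)
    rw [h]
    exact Ideal.mem_sup_right (Ideal.mem_span_singleton_self F)
  obtain ⟨G, hG, B, hB, hGB⟩ := Submodule.mem_sup.mp ((Ideal.eq_top_iff_one _).mp h)
  obtain ⟨H, rfl⟩ := Ideal.mem_span_singleton'.mp hB
  exact ⟨G, hG, H, hGB⟩

/-- If `X ∉ M`, write `1 = G + HX` with `G ∈ M`. Moving `X ^ n` past `H` gives `X ^ n = X ^ n G + H'
X ^ (n + 1) ∈ M`, and the exponent descends. This isolates the maximal left ideal lying over `Q =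
Y`. -/
theorem X_mem_of_X_pow_mem {M : Ideal (SkewPoly σ)} (hM : M.IsMaximal) (n : ℕ)
    (h : monomial σ n 1 ∈ M) : monomial σ 1 1 ∈ M := by
  induction n with
  | zero => exact absurd ((Ideal.eq_top_iff_one _).mpr h) hM.ne_top
  | succ n ih =>
    by_contra hX
    obtain ⟨G, hG, H, hGH⟩ := exists_add_mul_eq_one hM hX
    obtain ⟨H', hH'⟩ := exists_monomial_mul_eq n H
    refine hX (ih ?_)
    rw [← mul_one (monomial σ n 1), ← hGH, mul_add, ← mul_assoc, hH', mul_assoc,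
      monomial_mul_monomial, map_one, one_mul]
    exact add_mem (M.mul_mem_left _ hG) (M.mul_mem_left _ h)

end Action

end SkewPoly

end

/-! ### The number of monic irreducible polynomials over a finite field -/

section CountIrreducible

variable (k : Type*) [Field k] [Finite k]

theorem finite_monic_natDegree_eq (d : ℕ) : {Q : k[X] | Q.Monic ∧ Q.natDegree = d}.Finite := by
  refine Set.Finite.subset (s := (degreeLT k (d + 1) : Set k[X])) ?_ ?_
  · exact Set.finite_coe_iff.mp (Finite.of_equiv _ (degreeLTEquiv k (d + 1)).symm.toEquiv)
  · rintro Q ⟨-, rfl⟩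
    rw [SetLike.mem_coe, mem_degreeLT]
    exact degree_le_natDegree.trans_lt (by exact_mod_cast Nat.lt_succ_self _)

open UniqueFactorizationMonoid in
-- Compare degrees in the factorisation of `X ^ (q ^ n) - X`: it is separable, and its monic
-- irreducible factors are those of degree dividing `n`.
theorem sum_divisors_mul_card_irreducible (n : ℕ) (hn : 0 < n) :
    ∑ i ∈ n.divisors, i * {Q : k[X] | Q.Monic ∧ Irreducible Q ∧ Q.natDegree = i}.ncard =
      Nat.card k ^ n := by
  classical
  set q := Nat.card k with hq
  have hq1 : 1 < q := Finite.one_lt_card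
  set F : k[X] := X ^ q ^ n - X with hF
  have hF0 : F ≠ 0 := FiniteField.X_pow_card_pow_sub_X_ne_zero k hn.ne' hq1
  have hsep : F.Separable := by
    obtain ⟨p, hp⟩ := CharP.exists k
    refine galois_poly_separable p _ (dvd_pow ?_ hn.ne')
    have := Fintype.ofFinite k
    rw [hq, Nat.card_eq_fintype_card, ← CharP.cast_eq_zero_iff k, FiniteField.cast_card_eq_zero]
  have hnodup : (normalizedFactors F).Nodup :=
    (squarefree_iff_nodup_normalizedFactors hF0).mp hsep.squarefree
  set T := (normalizedFactors F).toFinset with hT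
  have hmem : ∀ Q : k[X], Q ∈ T ↔ Q.Monic ∧ Irreducible Q ∧ Q.natDegree ∣ n := by
    intro Q
    rw [hT, Multiset.mem_toFinset, Polynomial.mem_normalizedFactors_iff hF0]
    constructor
    · rintro ⟨h1, h2, h3⟩
      exact ⟨h2, h1, h1.natDegree_dvd_iff_dvd_X_pow_card_pow_sub_X.mpr h3⟩
    · rintro ⟨h1, h2, h3⟩
      exact ⟨h2, h1, h2.natDegree_dvd_iff_dvd_X_pow_card_pow_sub_X.mp h3⟩
  have hdeg : ∑ Q ∈ T, Q.natDegree = q ^ n := by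
    rw [← FiniteField.X_pow_card_pow_sub_X_natDegree_eq k hn.ne' hq1, ← hF,
      ← natDegree_prod_of_monic T (fun Q => Q) fun Q hQ => ((hmem Q).mp hQ).1]
    refine natDegree_eq_of_degree_eq (degree_eq_degree_of_associated ?_)
    have : ∏ Q ∈ T, Q = (normalizedFactors F).prod := by
      rw [Finset.prod_eq_multiset_prod, hT, Multiset.toFinset_val, hnodup.dedup, Multiset.map_id']
    rw [this]
    exact prod_normalizedFactors hF0
  rw [← hdeg, ← Finset.sum_fiberwise_of_maps_to (t := n.divisors) (g := natDegree)
    fun Q hQ => Nat.mem_divisors.mpr ⟨((hmem Q).mp hQ).2.2, hn.ne'⟩]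
  refine Finset.sum_congr rfl fun i hi => ?_
  rw [Finset.sum_congr rfl fun Q hQ => (Finset.mem_filter.mp hQ).2, Finset.sum_const, smul_eq_mul,
    mul_comm, ← Set.ncard_coe_finset]
  congr 2
  ext Q
  simp only [Set.mem_ofPred_eq, Finset.coe_filter, hmem]
  have := Nat.dvd_of_mem_divisors hi
  constructor
  · rintro ⟨h1, h2, rfl⟩
    exact ⟨⟨h1, h2, this⟩, rfl⟩
  · rintro ⟨⟨h1, h2, -⟩, h4⟩
    exact ⟨h1, h2, h4⟩

theorem mul_card_irreducible_eq (d : ℕ) (hd : 0 < d) :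
    (d : ℚ) * {Q : k[X] | Q.Monic ∧ Irreducible Q ∧ Q.natDegree = d}.ncard =
      ∑ i ∈ d.divisors, (ArithmeticFunction.moebius (d / i) : ℚ) * (Nat.card k : ℚ) ^ i := by
  have h := (ArithmeticFunction.sum_eq_iff_sum_mul_moebius_eq (R := ℚ)
    (f := fun i => (i : ℚ) * {Q : k[X] | Q.Monic ∧ Irreducible Q ∧ Q.natDegree = i}.ncard)
    (g := fun n => (Nat.card k : ℚ) ^ n)).mp (fun n hn => by
      exact_mod_cast sum_divisors_mul_card_irreducible k n hn) d hd
  rw [← h, Nat.sum_divisorsAntidiagonal'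
    (f := fun a b => (ArithmeticFunction.moebius a : ℚ) * (Nat.card k : ℚ) ^ b)]

end CountIrreducible

noncomputable section

namespace SkewPoly

/-! ### The centre of `K[X, σ]` and the quotients by `Q(X ^ r)` -/

section Central

variable (k K : Type*) [Field k] [Fintype k] [Field K] [Algebra k K]

variable {K} in
theorem frob_algebraMap (a : k) : frob k K (algebraMap k K a) = algebraMap k K a :=
  (FiniteField.frobeniusAlgHom k K).commutes a

variable {K} in
theorem frob_pow_algebraMap (n : ℕ) (a : k) :
    (frob k K ^ n) (algebraMap k K a) = algebraMap k K a := by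
  rw [RingHom.coe_pow]
  exact Function.iterate_fixed (frob_algebraMap k a) n

/-- The embedding `f ↦ f(X ^ r)` of `k[Y]` onto the centre of `K[X, σ]`, where `r = [K : k]`. -/
def centralHom : k[X] →+* SkewPoly (frob k K) :=
  eval₂RingHom'
    { toFun := fun a => monomial (frob k K) 0 (algebraMap k K a)
      map_one' := by rw [map_one]; rfl
      map_mul' := fun a b => by rw [monomial_mul_monomial, map_mul]; rfl
      map_zero' := by rw [map_zero, monomial_zero]
      map_add' := fun a b => by rw [map_add, monomial_add] }
    (monomial (frob k K) (Module.finrank k K) 1)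
    (fun a => by
      change monomial _ _ _ * monomial _ _ _ = monomial _ _ _ * monomial _ _ _
      rw [monomial_mul_monomial, monomial_mul_monomial, frob_pow_algebraMap, map_one, add_comm,
        mul_comm])

variable {k K} in
theorem centralHom_monomial (n : ℕ) (a : k) : centralHom k K (Polynomial.monomial n a) =
    monomial (frob k K) (Module.finrank k K * n) (algebraMap k K a) := by
  change eval₂ _ _ _ = _
  rw [eval₂_monomial, monomial_one_pow]
  change monomial _ _ _ * monomial _ _ _ = _
  rw [monomial_mul_monomial, map_one, mul_one, zero_add]

variable [Finite K]

theorem frob_pow_finrank_mul (n : ℕ) (a : K) : (frob k K ^ (Module.finrank k K * n)) a = a := by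
  rw [RingHom.coe_pow, Function.iterate_mul]
  exact Function.iterate_fixed (frob_iterate_finrank k K a) n

/-- `σ ^ i` is injective and cancels, and the Frobenius has order exactly `r`. -/
theorem finrank_dvd_of_frob_pow {i m : ℕ} (him : i ≤ m)
    (h : ∀ a, (frob k K ^ i) a = (frob k K ^ m) a) : Module.finrank k K ∣ m - i := by
  rw [← FiniteField.orderOf_frobeniusAlgHom k K, orderOf_dvd_iff_pow_eq_one]
  ext a
  have h1 := h a
  rw [show m = i + (m - i) by omega, pow_add, RingHom.mul_def, RingHom.comp_apply] at h1
  have h2 := (frob k K ^ i).injective h1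
  rw [RingHom.coe_pow] at h2
  rw [AlgHom.coe_pow]
  exact h2.symm

variable {k K}

theorem coeff_centralHom (f : k[X]) (n : ℕ) :
    (centralHom k K f).coeff (Module.finrank k K * n) = algebraMap k K (f.coeff n) := by
  induction f using Polynomial.induction_on' with
  | add f g hf hg => simp [hf, hg]
  | monomial m a =>
    rw [centralHom_monomial, coeff_monomial, Polynomial.coeff_monomial]
    simp only [mul_right_inj' (Module.finrank_pos (R := k) (M := K)).ne']
    split_ifs <;> simp

theorem coeff_centralHom_of_not_dvd (f : k[X]) {n : ℕ} (h : ¬ Module.finrank k K ∣ n) :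
    (centralHom k K f).coeff n = 0 := by
  induction f using Polynomial.induction_on' with
  | add f g hf hg => simp [hf, hg]
  | monomial m a =>
    rw [centralHom_monomial, coeff_monomial, if_neg]
    rintro rfl
    exact h (dvd_mul_right _ _)

theorem centralHom_mul_comm (f : k[X]) (F : SkewPoly (frob k K)) :
    centralHom k K f * F = F * centralHom k K f := by
  induction f using Polynomial.induction_on' with
  | add f g hf hg => simp [hf, hg, add_mul, mul_add]
  | monomial m a =>
    rw [centralHom_monomial]
    induction F using induction with
    | zero => simp
    | add F G hF hG => simp [hF, hG, add_mul, mul_add]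
    | monomial n b =>
      rw [monomial_mul_monomial, monomial_mul_monomial, frob_pow_finrank_mul, frob_pow_algebraMap,
        add_comm, mul_comm b]

theorem centralHom_mem_degreeLT (f : k[X]) :
    centralHom k K f ∈ degreeLT (frob k K) (Module.finrank k K * f.natDegree + 1) := by
  intro i hi
  by_cases h : Module.finrank k K ∣ i
  · obtain ⟨n, rfl⟩ := h
    rw [coeff_centralHom, coeff_eq_zero_of_natDegree_lt, map_zero]
    exact lt_of_mul_lt_mul_left' (a := Module.finrank k K) (by omega)
  · exact coeff_centralHom_of_not_dvd f h

theorem natDegree_centralHom {f : k[X]} (hf : f.Monic) :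
    (centralHom k K f).natDegree = Module.finrank k K * f.natDegree :=
  natDegree_eq_of_mem_degreeLT (centralHom_mem_degreeLT f) (by
    rw [coeff_centralHom, hf.coeff_natDegree, map_one]
    exact one_ne_zero)

theorem monic_centralHom {f : k[X]} (hf : f.Monic) : (centralHom k K f).Monic := by
  rw [Monic, natDegree_centralHom hf, coeff_centralHom, hf.coeff_natDegree, map_one]

theorem exists_centralHom_eq {F : SkewPoly (frob k K)}
    (h1 : ∀ i, F.coeff i ≠ 0 → Module.finrank k K ∣ i)
    (h2 : ∀ i, frob k K (F.coeff i) = F.coeff i) : ∃ f, centralHom k K f = F := by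
  choose c hc using fun i => mem_range_of_frob_eq k K (h2 i)
  -- The range is longer than necessary, but harmless: for `j` beyond it, `r * j ≥ j` exceeds the
  -- degree of `F`.
  refine ⟨∑ j ∈ Finset.range (F.natDegree + 1),
    Polynomial.monomial j (c (Module.finrank k K * j)), ?_⟩
  ext n
  by_cases h : Module.finrank k K ∣ n
  · obtain ⟨j, rfl⟩ := h
    rw [coeff_centralHom, finsetSum_coeff]
    simp only [Polynomial.coeff_monomial, Finset.sum_ite_eq', Finset.mem_range]
    split_ifs with hj
    · exact hc _
    · rw [map_zero, mem_degreeLT_natDegree_succ F]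
      exact (not_lt.mp hj).trans (Nat.le_mul_of_pos_left j (Module.finrank_pos (R := k) (M := K)))
  · rw [coeff_centralHom_of_not_dvd _ h]
    by_contra h0
    exact h (h1 n (Ne.symm h0))

theorem frob_eq_of_finrank_eq_one (h : Module.finrank k K = 1) (a : K) : frob k K a = a := by
  simpa [h] using frob_iterate_finrank k K a

/-- A two-sided ideal that contains `Q(X ^ r)` is generated by some `f(X ^ r)`. -/
theorem exists_eq_span_centralHom {Q : k[X]} (hirr : Irreducible Q) (hm : Q.Monic)
    (hQ : Q ≠ X ∨ Module.finrank k K = 1) (I : Ideal (SkewPoly (frob k K))) [I.IsTwoSided]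
    (hI : centralHom k K Q ∈ I) : ∃ f, I = Ideal.span {centralHom k K f} := by
  have hI0 : I ≠ ⊥ := by
    rintro rfl
    exact (monic_centralHom hm).ne_zero hI
  obtain ⟨P, hP, rfl⟩ := exists_monic_span_eq hI0
  set m := P.natDegree with hmdef
  have hPI := Ideal.mem_span_singleton_self P
  have hdvd : ∀ i, P.coeff i ≠ 0 → i ≤ m ∧ Module.finrank k K ∣ m - i := by
    intro i hi
    have him : i ≤ m := by
      by_contra h
      exact hi (mem_degreeLT_natDegree_succ P i (by omega))
    refine ⟨him, finrank_dvd_of_frob_pow k K him fun a => ?_⟩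
    -- `P a - σ ^ m(a) P` lies in the two-sided ideal and has degree less than `m`, so it is zero. A
    -- nonzero coefficient at `i` then forces `σ ^ i = σ ^ m`.
    have h := hP.eq_zero_of_mem_span
      (F := P * monomial _ 0 a - monomial _ 0 ((frob k K ^ m) a) * P)
      (sub_mem (Ideal.mul_mem_right _ _ hPI) (Ideal.mul_mem_left _ _ hPI)) (by
        intro j hj
        rw [coeff_commutator_C]
        rcases eq_or_lt_of_le hj with rfl | hj
        · rw [sub_self, mul_zero]
        · rw [mem_degreeLT_natDegree_succ P j hj, zero_mul])
    have h2 := coeff_commutator_C P a ((frob k K ^ m) a) i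
    rw [h, coeff_zero, eq_comm, mul_eq_zero] at h2
    exact sub_eq_zero.mp (h2.resolve_left hi)
  suffices h : ∃ f, centralHom k K f = P by
    obtain ⟨f, hf⟩ := h
    exact ⟨f, by rw [hf]⟩
  by_cases hr : Module.finrank k K = 1
  · exact exists_centralHom_eq (fun i _ => hr ▸ one_dvd i)
      fun i => frob_eq_of_finrank_eq_one hr _
  -- Since `P` divides `Q(X ^ r)` on the right, a zero constant term would give `Q(0) = 0`, hence `Q
  -- = X`.
  have hP0 : P.coeff 0 ≠ 0 := by
    intro h0
    obtain ⟨G, hG⟩ := Ideal.mem_span_singleton'.mp hI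
    have h1 := congrArg (fun F => coeff F 0) hG
    have h2 := coeff_centralHom (K := K) Q 0
    rw [mul_zero] at h2
    simp only [coeff_mul_zero, h0, mul_zero, h2] at h1
    have h3 : X ∣ Q := X_dvd_iff.mpr ((map_eq_zero _).mp h1.symm)
    exact (hQ.resolve_right hr)
      (eq_of_monic_of_associated hm monic_X (irreducible_X.associated_of_dvd hirr h3).symm)
  -- The terms of degree `m + 1` in `XP - PX` cancel, so this element of the ideal is `cP` with `c ∈
  -- K`. Its constant term is `0` while that of `P` is not, so `c = 0`.
  set T := monomial (frob k K) 1 1 * P - P * monomial (frob k K) 1 1 with hT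
  have hTI : T ∈ Ideal.span {P} :=
    sub_mem (Ideal.mul_mem_left _ _ hPI) (Ideal.mul_mem_right _ _ hPI)
  have hTdeg : ∀ i, m < i → T.coeff i = 0 := by
    intro i hi
    obtain ⟨j, rfl⟩ := Nat.exists_eq_add_of_lt hi
    rw [hT, coeff_commutator_X_succ]
    rcases Nat.eq_zero_or_pos j with rfl | hj
    · rw [add_zero, hP, map_one, sub_self]
    · rw [mem_degreeLT_natDegree_succ P _ (by omega), map_zero, sub_self]
  have hU := hP.eq_zero_of_mem_span (F := T - monomial _ 0 (T.coeff m) * P)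
    (sub_mem hTI (Ideal.mul_mem_left _ _ hPI)) (by
      intro i hi
      rw [coeff_sub, monomial_zero_mul_coeff]
      rcases eq_or_lt_of_le hi with rfl | hi
      · rw [hP, mul_one, sub_self]
      · rw [hTdeg i hi, mem_degreeLT_natDegree_succ P i hi, mul_zero, sub_zero])
  have hc : T.coeff m = 0 := by
    have := congrArg (fun F => coeff F 0) hU
    simp only [coeff_sub, monomial_zero_mul_coeff, coeff_zero] at this
    rw [hT, coeff_commutator_X_zero, ← hT, zero_sub, neg_eq_zero, mul_eq_zero] at this
    exact this.resolve_right hP0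
  rw [hc, monomial_zero, zero_mul, sub_zero] at hU
  refine exists_centralHom_eq (fun i hi => ?_) fun i => ?_
  · have h0 := (hdvd 0 hP0).2
    obtain ⟨hi1, hi2⟩ := hdvd i hi
    rw [Nat.sub_zero] at h0
    exact (Nat.dvd_sub_iff_right hi1 h0).mp hi2
  · have := coeff_commutator_X_succ P i
    rw [← hT, hU, coeff_zero] at this
    exact (sub_eq_zero.mp this.symm)

instance isTwoSided_span_centralHom (f : k[X]) : (Ideal.span {centralHom k K f}).IsTwoSided where
  mul_mem_of_left b h := by
    obtain ⟨c, rfl⟩ := Ideal.mem_span_singleton'.mp h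
    rw [mul_assoc, centralHom_mul_comm, ← mul_assoc]
    exact Ideal.mul_mem_left _ _ (Ideal.mem_span_singleton_self _)

/-- If `Q ∤ f`, a Bézout relation would put `1` in an ideal whose monic generator has positive
degree. -/
theorem centralHom_mem_span_iff {Q : k[X]} (hirr : Irreducible Q) (hm : Q.Monic) (f : k[X]) :
    centralHom k K f ∈ Ideal.span {centralHom k K Q} ↔ Q ∣ f := by
  constructor
  · intro h
    by_contra hQf
    obtain ⟨u, v, huv⟩ := (hirr.coprime_iff_not_dvd).mpr hQf
    have h1 : (1 : SkewPoly (frob k K)) ∈ Ideal.span {centralHom k K Q} := by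
      rw [← map_one (centralHom k K), ← huv, map_add, map_mul, map_mul]
      exact add_mem (Ideal.mul_mem_left _ _ (Ideal.mem_span_singleton_self _))
        (Ideal.mul_mem_left _ _ h)
    have h2 := (monic_centralHom hm).eq_zero_of_mem_span h1 (by
      rw [natDegree_centralHom hm]
      intro i hi
      have := Nat.mul_pos (Module.finrank_pos (R := k) (M := K)) hirr.natDegree_pos
      rw [coeff_one, if_neg (by omega)])
    have h3 := congrArg (fun F => coeff F 0) h2
    simp [coeff_one] at h3
  · rintro ⟨g, rfl⟩
    rw [mul_comm, map_mul]
    exact Ideal.mul_mem_left _ _ (Ideal.mem_span_singleton_self _)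

/-- A two-sided ideal pulls back to one generated by some `f(X ^ r)`. Either `Q ∣ f` and the ideal
is zero, or `Q` and `f` are coprime and it is everything. -/
theorem isSimpleRing_quotient {Q : k[X]} (hirr : Irreducible Q) (hm : Q.Monic)
    (hQ : Q ≠ X ∨ Module.finrank k K = 1) :
    IsSimpleRing (SkewPoly (frob k K) ⧸ Ideal.span {centralHom k K Q}) := by
  rw [isSimpleRing_iff_isTwoSided_imp]
  refine ⟨?_, fun I hI => ?_⟩
  · refine Ideal.Quotient.nontrivial_iff.mpr fun h => ?_
    have h1 : centralHom k K 1 ∈ Ideal.span {centralHom k K Q} := h ▸ Submodule.mem_top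
    exact hirr.not_isUnit (isUnit_of_dvd_one ((centralHom_mem_span_iff hirr hm 1).mp h1))
  · let π := Ideal.Quotient.mk (Ideal.span {centralHom k K Q})
    have hπ : Function.Surjective π := Ideal.Quotient.mk_surjective
    have hQI : centralHom k K Q ∈ I.comap π := by
      rw [Ideal.mem_comap, Ideal.Quotient.eq_zero_iff_mem.mpr (Ideal.mem_span_singleton_self _)]
      exact zero_mem _
    obtain ⟨f, hf⟩ := exists_eq_span_centralHom hirr hm hQ (I.comap π) hQI
    have hfI : centralHom k K f ∈ I.comap π := hf ▸ Ideal.mem_span_singleton_self _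
    rw [← Ideal.map_comap_of_surjective π hπ I]
    by_cases hQf : Q ∣ f
    · left
      rw [hf, eq_bot_iff, Ideal.map_le_iff_le_comap, Ideal.span_singleton_le_iff_mem,
        Ideal.mem_comap, Ideal.mem_bot, Ideal.Quotient.eq_zero_iff_mem]
      exact (centralHom_mem_span_iff hirr hm f).mpr hQf
    · right
      obtain ⟨u, v, huv⟩ := (hirr.coprime_iff_not_dvd).mpr hQf
      have h1 : (1 : SkewPoly (frob k K)) ∈ I.comap π := by
        rw [← map_one (centralHom k K), ← huv, map_add, map_mul, map_mul]
        exact add_mem (Ideal.mul_mem_left _ _ hQI) (Ideal.mul_mem_left _ _ hfI)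
      rw [(Ideal.eq_top_iff_one _).mpr h1, Ideal.map_top]

/-- A central class is represented by its remainder `F` of degree less than `r d`. Its commutators
with constants and with `X` vanish modulo `Q(X ^ r)`; degree bounds make them vanish exactly, so `F`
comes from `k[Y]`. -/
theorem natCard_center_quotient {Q : k[X]} (hirr : Irreducible Q) (hm : Q.Monic) :
    Nat.card (Subring.center (SkewPoly (frob k K) ⧸ Ideal.span {centralHom k K Q})) =
      Nat.card k ^ Q.natDegree := by
  let J := Ideal.span {centralHom k K Q}
  let π := Ideal.Quotient.mk J
  have hπ : Function.Surjective π := Ideal.Quotient.mk_surjective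
  have hcent : ∀ f, π (centralHom k K f) ∈ Subring.center (SkewPoly (frob k K) ⧸ J) := by
    intro f
    rw [Subring.mem_center_iff]
    intro x
    obtain ⟨F, rfl⟩ := hπ x
    rw [← map_mul, ← map_mul, centralHom_mul_comm]
  let g : k[X] →+* Subring.center (SkewPoly (frob k K) ⧸ J) :=
    (π.comp (centralHom k K)).codRestrict _ hcent
  have hker : ∀ f, g f = 0 ↔ f ∈ Ideal.span {Q} := by
    intro f
    rw [Ideal.mem_span_singleton, ← centralHom_mem_span_iff (K := K) hirr hm f,
      ← Ideal.Quotient.eq_zero_iff_mem, Subtype.ext_iff]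
    rfl
  have hsurj : Function.Surjective g := by
    rintro ⟨x, hx⟩
    obtain ⟨F', rfl⟩ := hπ x
    obtain ⟨G, F, hF, hFF⟩ := (monic_centralHom (K := K) hm).exists_eq_mul_add F'
    have hGJ : G * centralHom k K Q ∈ J :=
      Ideal.mul_mem_left _ _ (Ideal.mem_span_singleton_self _)
    have hπF : π F' = π F := by
      rw [hFF, map_add, Ideal.Quotient.eq_zero_iff_mem.mpr hGJ, zero_add]
    have hcomm : ∀ H, H * F - F * H ∈ J := by
      intro H
      rw [← Ideal.Quotient.eq_zero_iff_mem, map_sub, map_mul, map_mul, sub_eq_zero]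
      rw [hπF] at hx
      exact Subring.mem_center_iff.mp hx (π H)
    have h1 : ∀ i, F.coeff i ≠ 0 → Module.finrank k K ∣ i := by
      intro i hi
      refine finrank_dvd_of_frob_pow k K (Nat.zero_le i) fun a => ?_
      have h := (monic_centralHom hm).eq_zero_of_mem_span
        (F := F * monomial _ 0 a - monomial _ 0 a * F)
        (by rw [← neg_sub]; exact neg_mem (hcomm _))
        (fun j hj => by rw [coeff_commutator_C, hF j hj, zero_mul])
      have h2 := coeff_commutator_C F a a i
      rw [h, coeff_zero, eq_comm, mul_eq_zero] at h2
      exact (sub_eq_zero.mp (h2.resolve_left hi)).symm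
    have h2 : ∀ i, frob k K (F.coeff i) = F.coeff i := by
      intro i
      have h := (monic_centralHom hm).eq_zero_of_mem_span (hcomm (monomial _ 1 1)) (by
        rintro (_ | j) hj
        · exact coeff_commutator_X_zero F
        rw [coeff_commutator_X_succ, sub_eq_zero]
        by_cases hr : Module.finrank k K = 1
        · exact frob_eq_of_finrank_eq_one hr _
        -- `XF - FX` could reach degree `r d`, one too many. That coefficient comes from `F` at `r d
        -- - 1`, an exponent not divisible by `r` when `r > 1`.
        rcases eq_or_lt_of_le hj with hj | hj
        · have : F.coeff j = 0 := by
            by_contra h0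
            have h3 := h1 j h0
            rw [natDegree_centralHom hm] at hj
            have h4 : Module.finrank k K ∣ j + 1 := hj ▸ dvd_mul_right _ _
            exact hr (Nat.dvd_one.mp ((Nat.dvd_add_right h3).mp h4))
          rw [this, map_zero]
        · rw [hF j (by omega), map_zero])
      have h5 := coeff_commutator_X_succ F i
      rw [h, coeff_zero] at h5
      exact sub_eq_zero.mp h5.symm
    obtain ⟨f, hf⟩ := exists_centralHom_eq h1 h2
    refine ⟨f, Subtype.ext ?_⟩
    change π (centralHom k K f) = π F'
    rw [hf, hπF]
  rw [← natCard_quotient_eq g.toAddMonoidHom hsurj hker]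
  have : Module.Finite k (k[X] ⧸ Ideal.span {Q}) := hm.finite_quotient
  rw [Module.natCard_eq_pow_finrank (K := k), finrank_quotient_span_eq_natDegree]

end Central

end SkewPoly

end

noncomputable section

namespace SkewPoly

/-! ### The fibres of `Ψ` and the two counts -/

section Count

variable {k K : Type*} [Field k] [Fintype k] [Field K] [Algebra k K] [Finite K]

/-- The endomorphism `φ ^ r` of `D_P`, where `r = [K : k]`. -/
abbrev frobPow (P : SkewPoly (frob k K)) : Module.End K (Fin P.natDegree → K) :=
  P.phiPow (Module.finrank k K) (frob_iterate_finrank k K)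

theorem act_centralHom (P : SkewPoly (frob k K)) (f : k[X]) (v : Fin P.natDegree → K) :
    P.act (centralHom k K f) v = aeval P.frobPow (f.map (algebraMap k K)) v := by
  induction f using Polynomial.induction_on' with
  | add f g hf hg =>
    rw [Polynomial.map_add, map_add, map_add, map_add, LinearMap.add_apply, ← hf, ← hg]
    rfl
  | monomial n a =>
    rw [centralHom_monomial, act_monomial, Polynomial.map_monomial, aeval_monomial,
      Module.algebraMap_end_eq_smul_id, Module.End.mul_apply, Module.End.pow_apply,
      Function.iterate_mul]
    rfl

/-- A central element that kills `e₀` kills all of `D_P = A e₀`. -/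
theorem Monic.centralHom_mem_span_iff {P : SkewPoly (frob k K)} (hP : P.Monic) (f : k[X]) :
    centralHom k K f ∈ Ideal.span {P} ↔ aeval P.frobPow (f.map (algebraMap k K)) = 0 := by
  constructor
  · intro h
    refine LinearMap.ext fun v => ?_
    obtain ⟨F, rfl⟩ := P.ev_surjective v
    rw [← act_centralHom, ← ev_mul, centralHom_mul_comm, ev_mul, (hP.ev_eq_zero_iff _).mpr h,
      map_zero, LinearMap.zero_apply]
  · intro h
    rw [← hP.ev_eq_zero_iff, ← mul_one (centralHom k K f), ev_mul, act_centralHom, h,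
      LinearMap.zero_apply]

theorem Monic.centralHom_Psi_mem_span {P : SkewPoly (frob k K)} (hP : P.Monic) :
    centralHom k K P.Psi ∈ Ideal.span {P} := by
  rw [hP.centralHom_mem_span_iff, map_Psi]
  exact LinearMap.aeval_self_charpoly _

theorem monic_Psi (P : SkewPoly (frob k K)) : P.Psi.Monic := by
  refine monic_of_injective (algebraMap k K).injective ?_
  rw [map_Psi]
  exact LinearMap.charpoly_monic _

theorem natDegree_Psi (P : SkewPoly (frob k K)) : P.Psi.natDegree = P.natDegree := by
  rw [← natDegree_map (algebraMap k K), map_Psi, charpolyPhiPow, LinearMap.charpoly_natDegree,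
    Module.finrank_fin_fun]

/-- If `Q` and `Ψ(P)` were coprime, `1` would lie in `AP`. So `Q ∣ Ψ(P)`, and both are monic of the
same degree. -/
theorem Monic.Psi_eq_of_mem_span {P : SkewPoly (frob k K)} (hP : P.Monic) {Q : k[X]}
    (hirr : Irreducible Q) (hm : Q.Monic) (hd : P.natDegree = Q.natDegree)
    (hQ : centralHom k K Q ∈ Ideal.span {P}) : P.Psi = Q := by
  have hdvd : Q ∣ P.Psi := by
    by_contra h
    obtain ⟨u, v, huv⟩ := (hirr.coprime_iff_not_dvd).mpr h
    have h1 : (1 : SkewPoly (frob k K)) ∈ Ideal.span {P} := by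
      rw [← map_one (centralHom k K), ← huv, map_add, map_mul, map_mul]
      exact add_mem (Ideal.mul_mem_left _ _ hQ)
        (Ideal.mul_mem_left _ _ hP.centralHom_Psi_mem_span)
    refine one_ne_zero (hP.eq_zero_of_mem_span h1 fun i hi => ?_)
    have := hirr.natDegree_pos
    rw [coeff_one, if_neg (by omega)]
  exact eq_of_monic_of_dvd_of_natDegree_le hm P.monic_Psi hdvd (by rw [natDegree_Psi, hd])

/-- The maximal left ideals that contain `Q(X ^ r)`. -/
theorem maximal_ideals_over {Q : k[X]} (hirr : Irreducible Q) (hm : Q.Monic)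
    (hQ : Q ≠ X ∨ Module.finrank k K = 1) :
    (∀ P : SkewPoly (frob k K), P.Monic → (Ideal.span {P}).IsMaximal →
      centralHom k K Q ∈ Ideal.span {P} → P.natDegree = Q.natDegree) ∧
    {M : Ideal (SkewPoly (frob k K)) | M.IsMaximal ∧ centralHom k K Q ∈ M}.ncard *
      (Nat.card k ^ Q.natDegree - 1) = Nat.card k ^ (Q.natDegree * Module.finrank k K) - 1 := by
  have hq : 1 < Nat.card k := Finite.one_lt_card
  have hd := hirr.natDegree_pos
  have hr : 0 < Module.finrank k K := Module.finrank_pos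
  have hsimple := isSimpleRing_quotient (K := K) hirr hm hQ
  have hcardR := (monic_centralHom (K := K) hm).natCard_quotient
  have hfin : Finite (SkewPoly (frob k K) ⧸ Ideal.span {centralHom k K Q}) := by
    refine (Nat.card_pos_iff.mp ?_).2
    rw [hcardR]
    exact pow_pos Nat.card_pos _
  obtain ⟨n, h1, h2, h3⟩ := IsSimpleRing.exists_card_maximal_of_surjective _
    (Ideal.Quotient.mk (Ideal.span {centralHom k K Q})) Ideal.Quotient.mk_surjective
  rw [natCard_center_quotient hirr hm] at h1 h2 h3
  -- The order of the quotient is `|K| ^ (r d) = q ^ (d * r ^ 2)`, to be compared with `(q ^ d) ^ (n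
  -- * n)`.
  have hn : n = Module.finrank k K := by
    rw [hcardR, natDegree_centralHom hm, Module.natCard_eq_pow_finrank (K := k) (V := K),
      ← pow_mul, ← pow_mul] at h1
    have h4 := Nat.pow_right_injective hq h1
    rw [← mul_assoc, mul_comm, Nat.mul_right_inj hd.ne'] at h4
    exact (Nat.mul_self_inj.mp h4).symm
  rw [Ideal.mk_ker, hn] at h2 h3
  have hle : ∀ M : Ideal (SkewPoly (frob k K)),
      Ideal.span {centralHom k K Q} ≤ M ↔ centralHom k K Q ∈ M := fun M =>
    Ideal.span_singleton_le_iff_mem M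
  simp only [hle] at h2 h3
  refine ⟨fun P hP hM hQP => ?_, by rw [pow_mul]; exact h3⟩
  -- The order of `A/AP` is both `q ^ (r * deg P)` and `q ^ (d r)`.
  have h4 := h2 _ hM hQP
  rw [hP.natCard_quotient, Module.natCard_eq_pow_finrank (K := k) (V := K), ← pow_mul,
    ← pow_mul, mul_comm] at h4
  exact Nat.eq_of_mul_eq_mul_right hr (Nat.pow_right_injective hq h4)

/-- For maximality, take a maximal `AF ⊇ AP`. It contains `Q(X ^ r)`, so `deg F = deg Q = deg P`,
and two monic elements of `AF` of its least degree coincide. -/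
theorem Monic.Psi_eq_iff {P : SkewPoly (frob k K)} (hP : P.Monic) {Q : k[X]}
    (hirr : Irreducible Q) (hm : Q.Monic) (hQ : Q ≠ X ∨ Module.finrank k K = 1) :
    P.Psi = Q ↔ (Ideal.span {P}).IsMaximal ∧ centralHom k K Q ∈ Ideal.span {P} := by
  have hdeg := (maximal_ideals_over (K := K) hirr hm hQ).1
  constructor
  · rintro rfl
    refine ⟨?_, hP.centralHom_Psi_mem_span⟩
    have hd := hirr.natDegree_pos
    rw [natDegree_Psi] at hd
    have hne : Ideal.span {P} ≠ ⊤ := by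
      intro h
      refine one_ne_zero (hP.eq_zero_of_mem_span ((Ideal.eq_top_iff_one _).mp h) fun i hi => ?_)
      rw [coeff_one, if_neg (by omega)]
    obtain ⟨M, hM, hPM⟩ := Ideal.exists_le_maximal _ hne
    have hM0 : M ≠ ⊥ := by
      rintro rfl
      exact hP.ne_zero (hPM (Ideal.mem_span_singleton_self P))
    obtain ⟨F, hF, rfl⟩ := exists_monic_span_eq hM0
    have h1 := hdeg F hF hM (hPM hP.centralHom_Psi_mem_span)
    rw [natDegree_Psi] at h1
    have h2 := hF.eq_zero_of_mem_span
      (sub_mem (Ideal.mem_span_singleton_self F) (hPM (Ideal.mem_span_singleton_self P)))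
      (hF.sub_mem_degreeLT hP h1)
    rwa [← sub_eq_zero.mp h2]
  · rintro ⟨hM, hQP⟩
    exact hP.Psi_eq_of_mem_span hirr hm (hdeg P hP hM hQP) hQP

theorem ncard_Psi_eq_mul {Q : k[X]} (hirr : Irreducible Q) (hm : Q.Monic)
    (hQ : Q ≠ X ∨ Module.finrank k K = 1) :
    {P : SkewPoly (frob k K) | P.Monic ∧ P.Psi = Q}.ncard * (Nat.card k ^ Q.natDegree - 1) =
      Nat.card k ^ (Q.natDegree * Module.finrank k K) - 1 := by
  rw [← (maximal_ideals_over (K := K) hirr hm hQ).2]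
  congr 1
  refine Set.ncard_congr (fun P _ => Ideal.span {P}) ?_ ?_ ?_
  · rintro P ⟨hP, h⟩
    exact (hP.Psi_eq_iff hirr hm hQ).mp h
  · rintro P F ⟨hP, -⟩ ⟨hF, -⟩ h
    exact hP.eq_of_span_eq hF h
  · rintro M ⟨hM, hQM⟩
    have hM0 : M ≠ ⊥ := by
      rintro rfl
      exact (monic_centralHom hm).ne_zero hQM
    obtain ⟨P, hP, rfl⟩ := exists_monic_span_eq hM0
    exact ⟨P, ⟨hP, (hP.Psi_eq_iff hirr hm hQ).mpr ⟨hM, hQM⟩⟩, rfl⟩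

theorem ncard_Psi_eq {Q : k[X]} (hirr : Irreducible Q) (hm : Q.Monic)
    (hQ : Q ≠ X ∨ Module.finrank k K = 1) :
    ({P : SkewPoly (frob k K) | P.Monic ∧ P.Psi = Q}.ncard : ℚ) =
      ((Nat.card k : ℚ) ^ (Q.natDegree * Module.finrank k K) - 1) /
        ((Nat.card k : ℚ) ^ Q.natDegree - 1) := by
  have hq : 1 < Nat.card k := Finite.one_lt_card
  have h1 : 1 < Nat.card k ^ Q.natDegree := Nat.one_lt_pow hirr.natDegree_pos.ne' hq
  have h0 : ((Nat.card k : ℚ) ^ Q.natDegree - 1) ≠ 0 := by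
    have : (1 : ℚ) < (Nat.card k : ℚ) ^ Q.natDegree := by exact_mod_cast h1
    exact (sub_pos.mpr this).ne'
  rw [eq_div_iff h0]
  have h2 := ncard_Psi_eq_mul (K := K) hirr hm hQ
  have h3 : 1 ≤ Nat.card k ^ (Q.natDegree * Module.finrank k K) := Nat.one_le_pow _ _ (by omega)
  have h4 := congrArg (Nat.cast : ℕ → ℚ) h2
  push_cast [Nat.cast_sub h1.le, Nat.cast_sub h3] at h4
  exact h4

/-- An infinite set has `ncard` zero, which the positive right side of `ncard_Psi_eq_mul` excludes.
-/
theorem finite_Psi_eq {Q : k[X]} (hirr : Irreducible Q) (hm : Q.Monic)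
    (hQ : Q ≠ X ∨ Module.finrank k K = 1) :
    {P : SkewPoly (frob k K) | P.Monic ∧ P.Psi = Q}.Finite := by
  refine Set.finite_of_ncard_ne_zero fun h => ?_
  have h2 := ncard_Psi_eq_mul (K := K) hirr hm hQ
  have h1 : 1 < Nat.card k ^ (Q.natDegree * Module.finrank k K) :=
    Nat.one_lt_pow (Nat.mul_pos hirr.natDegree_pos (Module.finrank_pos (R := k) (M := K))).ne'
      Finite.one_lt_card
  rw [h, zero_mul] at h2
  omega

/-- A maximal left ideal of `K[X, σ]` meets the centre in a prime ideal. -/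
theorem isPrime_comap_centralHom {M : Ideal (SkewPoly (frob k K))} (hM : M.IsMaximal) :
    (M.comap (centralHom k K)).IsPrime where
  ne_top' := Ideal.comap_ne_top _ hM.ne_top
  mem_or_mem' {f g} h := by
    rw [or_iff_not_imp_right]
    intro hg
    -- With `1 = G + Hg` and `f` central, `f = fG + H(fg) ∈ M`.
    obtain ⟨G, hG, H, hGH⟩ := exists_add_mul_eq_one hM hg
    rw [Ideal.mem_comap, ← mul_one (centralHom k K f), ← hGH, mul_add, ← mul_assoc,
      centralHom_mul_comm f H, mul_assoc, ← map_mul]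
    exact add_mem (M.mul_mem_left _ hG) (M.mul_mem_left _ h)

/-- The contraction of `AP` to `k[Y]` is prime, and it is nonzero because it contains `Ψ(P)`. -/
theorem Monic.exists_irreducible_centralHom_mem {P : SkewPoly (frob k K)} (hP : P.Monic)
    (hM : (Ideal.span {P}).IsMaximal) :
    ∃ Q : k[X], Irreducible Q ∧ Q.Monic ∧ centralHom k K Q ∈ Ideal.span {P} := by
  have hne : (Ideal.span {P}).comap (centralHom k K) ≠ ⊥ := by
    intro h
    have h1 : P.Psi ∈ (Ideal.span {P}).comap (centralHom k K) := hP.centralHom_Psi_mem_span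
    rw [h, Ideal.mem_bot] at h1
    exact P.monic_Psi.ne_zero h1
  obtain ⟨f, hf, hfp⟩ := (isPrime_comap_centralHom hM).exists_mem_prime_of_ne_bot hne
  refine ⟨f * C f.leadingCoeff⁻¹, ?_, monic_mul_leadingCoeff_inv hfp.ne_zero, ?_⟩
  · exact irreducible_mul_leadingCoeff_inv.mpr hfp.irreducible
  · exact Ideal.mul_mem_right (I := (Ideal.span {P}).comap (centralHom k K)) _ hf

theorem Monic.irreducible_iff_Psi {P : SkewPoly (frob k K)} (hP : P.Monic)
    (hd : 2 ≤ P.natDegree ∨ Module.finrank k K = 1) : Irreducible P ↔ Irreducible P.Psi := by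
  rw [hP.irreducible_iff]
  constructor
  · intro hM
    obtain ⟨Q, hirr, hm, hQP⟩ := hP.exists_irreducible_centralHom_mem hM
    have hQ : Q ≠ X ∨ Module.finrank k K = 1 := by
      -- If `Q = X`, then `X ^ r` and hence `X` lies in `AP`, impossible when `deg P ≥ 2`.
      rw [or_iff_not_imp_right]
      rintro hr rfl
      rw [← monomial_one_one_eq_X, centralHom_monomial, map_one] at hQP
      have hX := hP.eq_zero_of_mem_span (X_mem_of_X_pow_mem hM _ hQP)
        (monomial_mem_degreeLT (by omega) 1)
      simpa [coeff_monomial] using congrArg (fun F => coeff F 1) hX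
    rwa [(hP.Psi_eq_iff hirr hm hQ).mpr ⟨hM, hQP⟩]
  · intro hirr
    refine ((hP.Psi_eq_iff hirr P.monic_Psi ?_).mp rfl).1
    refine hd.imp_left fun h hX => ?_
    have := P.natDegree_Psi
    rw [hX, natDegree_X] at this
    omega

/-- The set is fibred by `Ψ` over the monic irreducible `Q` of degree `d`, and all fibres have the
same size, depending only on `d`. -/
theorem ncard_irreducible (d : ℕ) (hd0 : 0 < d) (hd : 2 ≤ d ∨ Module.finrank k K = 1) :
    ({P : SkewPoly (frob k K) | P.Monic ∧ Irreducible P ∧ P.natDegree = d}.ncard : ℚ) =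
      {Q : k[X] | Q.Monic ∧ Irreducible Q ∧ Q.natDegree = d}.ncard *
        (((Nat.card k : ℚ) ^ (d * Module.finrank k K) - 1) / ((Nat.card k : ℚ) ^ d - 1)) := by
  classical
  have hS : {Q : k[X] | Q.Monic ∧ Irreducible Q ∧ Q.natDegree = d}.Finite :=
    (finite_monic_natDegree_eq k d).subset fun Q hQ => ⟨hQ.1, hQ.2.2⟩
  have hgood : ∀ Q ∈ hS.toFinset, Q ≠ X ∨ Module.finrank k K = 1 := by
    intro Q hQ
    refine hd.imp_left ?_
    rintro h rfl
    have := (hS.mem_toFinset.mp hQ).2.2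
    rw [natDegree_X] at this
    omega
  have hfin : ∀ Q ∈ hS.toFinset,
      {P : SkewPoly (frob k K) | P.Monic ∧ P.Psi = Q}.Finite := fun Q hQ =>
    have h := hS.mem_toFinset.mp hQ
    finite_Psi_eq h.2.1 h.1 (hgood Q hQ)
  have hunion : {P : SkewPoly (frob k K) | P.Monic ∧ Irreducible P ∧ P.natDegree = d} =
      ⋃ Q ∈ hS.toFinset, {P : SkewPoly (frob k K) | P.Monic ∧ P.Psi = Q} := by
    ext P
    simp only [Set.mem_ofPred_eq, Set.mem_iUnion, hS.mem_toFinset, exists_prop]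
    constructor
    · rintro ⟨hP, hirr, rfl⟩
      exact ⟨P.Psi, ⟨P.monic_Psi, (hP.irreducible_iff_Psi hd).mp hirr, P.natDegree_Psi⟩, hP, rfl⟩
    · rintro ⟨_, ⟨-, hirr, hdeg⟩, hP, rfl⟩
      rw [natDegree_Psi] at hdeg
      subst hdeg
      exact ⟨hP, (hP.irreducible_iff_Psi hd).mpr hirr, rfl⟩
  have hT : {P : SkewPoly (frob k K) | P.Monic ∧ Irreducible P ∧ P.natDegree = d}.Finite := by
    rw [hunion]
    exact hS.toFinset.finite_toSet.biUnion hfin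
  have hmaps : ∀ P ∈ hT.toFinset, P.Psi ∈ hS.toFinset := by
    intro P hP
    rw [hT.mem_toFinset, hunion] at hP
    simp only [Set.mem_iUnion, exists_prop] at hP
    obtain ⟨Q, hQ, -, rfl⟩ := hP
    exact hQ
  have hfiber : ∀ Q ∈ hS.toFinset, ((hT.toFinset.filter fun P => P.Psi = Q).card : ℚ) =
      ((Nat.card k : ℚ) ^ (d * Module.finrank k K) - 1) / ((Nat.card k : ℚ) ^ d - 1) := by
    intro Q hQ
    have h := hS.mem_toFinset.mp hQ
    have hset : ((hT.toFinset.filter fun P => P.Psi = Q : Finset _) : Set _) =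
        {P : SkewPoly (frob k K) | P.Monic ∧ P.Psi = Q} := by
      ext P
      rw [Finset.mem_coe, Finset.mem_filter, hT.mem_toFinset]
      refine ⟨fun hP => ⟨hP.1.1, hP.2⟩, fun hP => ⟨?_, hP.2⟩⟩
      rw [hunion]
      exact Set.mem_biUnion hQ hP
    rw [← Set.ncard_coe_finset, hset, ncard_Psi_eq h.2.1 h.1 (hgood Q hQ), h.2.2]
  rw [Set.ncard_eq_toFinset_card _ hT, Finset.card_eq_sum_card_fiberwise hmaps, Nat.cast_sum,
    Finset.sum_congr rfl hfiber, Finset.sum_const, nsmul_eq_mul, Set.ncard_eq_toFinset_card _ hS]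

end Count

end SkewPoly

end

theorem mainTheorem10 (k K : Type*) [Field k] [Fintype k] [Field K] [Finite K] [Algebra k K]
    (q r : ℕ) (hq : Fintype.card k = q) (hr : Module.finrank k K = r) :
    (∀ (d : ℕ) (Q : k[X]), Q.Monic → Irreducible Q → Q.natDegree = d → (Q ≠ X ∨ r = 1) →
      ({P : SkewPoly (SkewPoly.frob k K) | P.Monic ∧ P.Psi = Q}.ncard : ℚ) =
        ((q : ℚ) ^ (d * r) - 1) / ((q : ℚ) ^ d - 1)) ∧
    (∀ d : ℕ, 1 ≤ d → (2 ≤ d ∨ r = 1) →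
      ({P : SkewPoly (SkewPoly.frob k K) | P.Monic ∧ Irreducible P ∧ P.natDegree = d}.ncard : ℚ) =
        ((q : ℚ) ^ (d * r) - 1) / ((d : ℚ) * ((q : ℚ) ^ d - 1)) *
          ∑ i ∈ d.divisors, (ArithmeticFunction.moebius (d / i) : ℚ) * (q : ℚ) ^ i) := by
  rw [← Nat.card_eq_fintype_card] at hq
  subst hq hr
  refine ⟨?_, fun d hd0 hd => ?_⟩
  · rintro _ Q hm hirr rfl hQ
    exact SkewPoly.ncard_Psi_eq hirr hm hQ
  · have hdq : (d : ℚ) ≠ 0 := Nat.cast_ne_zero.mpr (by omega)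
    rw [SkewPoly.ncard_irreducible d hd0 hd, ← mul_card_irreducible_eq k d hd0, ← div_div,
      div_right_comm, ← mul_assoc, div_mul_cancel₀ _ hdq, mul_comm]
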